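/- Let $\mathbb{K}$ be a field of characteristic zero and $n\ge 0$ an integer. Let $\bar{\mathrm U}(n)$ be the localization of the polynomial ring $\mathbb{K}[\tilde h_1,\dots,\tilde h_n]$ at the multiplicative set generated by the elements $\tilde h_{ij}+k$, $i\neq j$, $k\in\mathbb{Z}$, where $\tilde h_{ij}=\tilde h_i-\tilde h_j$. Let $\mathrm{Diff}_{\mathbf h}(n)$ be the associative unital $\mathbb{K}$-algebra generated by $\bar{\mathrm U}(n)$ (that is, equipped with a homomorphism of $\mathbb{K}$-algebras from $\bar{\mathrm U}(n)$) and by elements $x^1,\dots,x^n,\bar\partial_1,\dots,\bar\partial_n$, with the defining relations $$\tilde h_i x^j=x^j(\tilde h_i+\delta_i^j),\qquad \tilde h_i\bar\partial_j=\bar\partial_j(\tilde h_i-\delta_i^j)\qquad\text{for all } i,j,$$ $$x^ix^j=\frac{\tilde h_{ij}+1}{\tilde h_{ij}}\,x^jx^i,\qquad \bar\partial_i\bar\partial_j=\frac{\tilde h_{ij}-1}{\tilde h_{ij}}\,\bar\partial_j\bar\partial_i,\qquad x^i\bar\partial_j=\bar\partial_jx^i\qquad\text{for } i<j,$$ $$x^i\bar\partial_j=\frac{\tilde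 h_{ij}(\tilde h_{ij}-2)}{(\tilde h_{ij}-1)^2}\,\bar\partial_jx^i\quad\text{for } i>j,\qquad x^i\bar\partial_i=\sum_{j=1}^n\frac{1}{1-\tilde h_{ij}}\,\bar\partial_jx^j-1\quad\text{for all } i.$$ Put $\Gamma_j=\bar\partial_jx^j$ and, for $k=1,\dots,n$, $$c_k=\sum_{j=1}^n\frac{\partial e_k}{\partial\tilde h_j}\,\Gamma_j-e_k,$$ where $e_k$ is the $k$-th elementary symmetric polynomial in $\tilde h_1,\dots,\tilde h_n$. Then the elements $c_1,\dots,c_n$ are central in $\mathrm{Diff}_{\mathbf h}(n)$, and there is an isomorphism of $\mathbb{K}$-algebras from the polynomial ring $\mathbb{K}[t_1,\dots,t_n]$ onto the center of $\mathrm{Diff}_{\mathbf h}(n)$ given by $t_j\mapsto c_j$, $j=1,\dots,n$. Moreover, the subring of weight zero elements, $\{f\in\mathrm{Diff}_{\mathbf h}(n):\tilde h_if=f\tilde h_i\text{ for all }i\}$, is freely generated over $\bar{\mathrm U}(n)$ by $c_1,\dots,c_n$: there is a ring isomorphism from $\bar{\mathrm U}(n)[t_1,\dots,t_n]$ onto it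 that restricts to the canonical map on $\bar{\mathrm U}(n)$ and sends $t_j$ to $c_j$ for $j=1,\dots,n$. -/

import Mathlib

/-! The ring `Diff_h(n)` of `h`-deformed differential operators of type A over a field `K`,
its elements `Γ_i` and `c_k`, and its subring of weight zero elements. Indices `1, …, n` are
represented by `Fin n` with its order. -/

noncomputable section

namespace HDiff

open MvPolynomial

universe u

section Ubar

variable (K : Type u) [Field K] (n : ℕ)

/-- The multiplicative set generated by `h̃_i - h̃_j + k`, `i ≠ j`, `k ∈ ℤ`, in
`U(n) = K[h̃_1, …, h̃_n]` (the enveloping algebra of the abelian Lie algebra with basis `h̃_i`). -/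
def denominators : Submonoid (MvPolynomial (Fin n) K) :=
  Submonoid.closure
    {p | ∃ i j : Fin n, i ≠ j ∧ ∃ k : ℤ, p = X i - X j + C (k : K)}

/-- The ring of fractions `Ū(n)` of `U(n)`. -/
abbrev Ubar : Type u := Localization (denominators K n)

variable {n}

/-- The element `h̃_i` of `Ū(n)`. -/
def ht (i : Fin n) : Ubar K n := algebraMap (MvPolynomial (Fin n) K) (Ubar K n) (X i)

/-- The element `h̃_{ij} = h̃_i - h̃_j` of `Ū(n)`. -/
def hd (i j : Fin n) : Ubar K n := ht K i - ht K j

theorem isUnit_hd_add_int {i j : Fin n} (hij : i ≠ j) (k : ℤ) :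
    IsUnit (hd K i j + (k : Ubar K n)) := by
  have h : (X i - X j + C (k : K) : MvPolynomial (Fin n) K) ∈ denominators K n :=
    Submonoid.subset_closure ⟨i, j, hij, k, rfl⟩
  simpa [hd, ht] using IsLocalization.map_units (Ubar K n) (⟨_, h⟩ : denominators K n)

theorem isUnit_hd {i j : Fin n} (hij : i ≠ j) : IsUnit (hd K i j) := by
  simpa using isUnit_hd_add_int K hij 0

theorem isUnit_hd_sub_one {i j : Fin n} (hij : i ≠ j) : IsUnit (hd K i j - 1) := by
  simpa [sub_eq_add_neg] using isUnit_hd_add_int K hij (-1)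

/-- The elements `1 - h̃_{ij}` are invertible in `Ū(n)`, for `i = j` too. -/
theorem isUnit_one_sub_hd (i j : Fin n) : IsUnit (1 - hd K i j) := by
  by_cases hij : i = j
  · subst hij
    simp [hd]
  · simpa using (isUnit_hd_sub_one K hij).neg

end Ubar

section Diff

variable (K : Type u) [Field K] (n : ℕ)

/-- Generators of the ring: the elements of `Ū(n)`, the `x^i`, and the `∂̄_i`. -/
inductive Gen : Type u
  | coeff (f : Ubar K n) : Gen
  | x (i : Fin n) : Gen
  | d (i : Fin n) : Gen

/-- An element of `Ū(n)` as a generator of the free algebra. -/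
def fU (f : Ubar K n) : FreeAlgebra K (Gen K n) := FreeAlgebra.ι K (Gen.coeff f)

variable {n} in
/-- The generator `x^i` of the free algebra. -/
def fx (i : Fin n) : FreeAlgebra K (Gen K n) := FreeAlgebra.ι K (Gen.x i)

variable {n} in
/-- The generator `∂̄_i` of the free algebra. -/
def fd (i : Fin n) : FreeAlgebra K (Gen K n) := FreeAlgebra.ι K (Gen.d i)

/-- The defining relations of `Diff_h(n)`. The first three say that `Ū(n)` maps to the ring by a
homomorphism of `K`-algebras, the next two are the weight relations, and the others are the
ordering relations. Every `Ring.inverse` below is applied to an invertible element. -/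
inductive Rel : FreeAlgebra K (Gen K n) → FreeAlgebra K (Gen K n) → Prop
  | coeff_add (f g : Ubar K n) : Rel (fU K n (f + g)) (fU K n f + fU K n g)
  | coeff_mul (f g : Ubar K n) : Rel (fU K n (f * g)) (fU K n f * fU K n g)
  | coeff_algebraMap (a : K) : Rel (fU K n (algebraMap K (Ubar K n) a)) (algebraMap K _ a)
  | weight_x (i j : Fin n) :
      Rel (fU K n (ht K i) * fx K j) (fx K j * fU K n (ht K i + if i = j then 1 else 0))
  | weight_d (i j : Fin n) :
      Rel (fU K n (ht K i) * fd K j) (fd K j * fU K n (ht K i - if i = j then 1 else 0))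
  | x_x (i j : Fin n) (hij : i < j) :
      Rel (fx K i * fx K j)
        (fU K n ((hd K i j + 1) * Ring.inverse (hd K i j)) * (fx K j * fx K i))
  | d_d (i j : Fin n) (hij : i < j) :
      Rel (fd K i * fd K j)
        (fU K n ((hd K i j - 1) * Ring.inverse (hd K i j)) * (fd K j * fd K i))
  | x_d_lt (i j : Fin n) (hij : i < j) : Rel (fx K i * fd K j) (fd K j * fx K i)
  | x_d_gt (i j : Fin n) (hij : j < i) :
      Rel (fx K i * fd K j)
        (fU K n (hd K i j * (hd K i j - 2) * Ring.inverse ((hd K i j - 1) ^ 2)) *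
          (fd K j * fx K i))
  | x_d_self (i : Fin n) :
      Rel (fx K i * fd K i)
        ((∑ j : Fin n, fU K n (Ring.inverse (1 - hd K i j)) * (fd K j * fx K j)) - 1)

/-- The ring `Diff_h(n)`. -/
def Diff : Type u := RingQuot (Rel K n)

instance : Ring (Diff K n) := inferInstanceAs (Ring (RingQuot (Rel K n)))

instance : Algebra K (Diff K n) := inferInstanceAs (Algebra K (RingQuot (Rel K n)))

/-- The projection from the free algebra. -/
def proj : FreeAlgebra K (Gen K n) →ₐ[K] Diff K n := RingQuot.mkAlgHom K (Rel K n)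

theorem proj_rel {a b : FreeAlgebra K (Gen K n)} (h : Rel K n a b) :
    proj K n a = proj K n b :=
  RingQuot.mkAlgHom_rel K h

/-- The structure homomorphism from `Ū(n)` to `Diff_h(n)`. -/
def ofU : Ubar K n →ₐ[K] Diff K n where
  toFun f := proj K n (fU K n f)
  map_one' := by
    have h := proj_rel K n (Rel.coeff_algebraMap (1 : K))
    simpa using h
  map_mul' f g := by
    rw [proj_rel K n (Rel.coeff_mul f g), map_mul]
  map_zero' := by
    have h := proj_rel K n (Rel.coeff_algebraMap (0 : K))
    simpa using h
  map_add' f g := by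
    rw [proj_rel K n (Rel.coeff_add f g), map_add]
  commutes' a := by
    have h := proj_rel K n (Rel.coeff_algebraMap a)
    rw [h, AlgHom.commutes]

variable {n} in
/-- The element `x^i` of `Diff_h(n)`. -/
def x (i : Fin n) : Diff K n := proj K n (fx K i)

variable {n} in
/-- The element `∂̄_i` of `Diff_h(n)`. -/
def d (i : Fin n) : Diff K n := proj K n (fd K i)

variable {n} in
/-- `Γ_i = ∂̄_i x^i`. -/
def Gam (i : Fin n) : Diff K n := d K i * x K i

/-- `c_k = ∑_j (∂e_k/∂h̃_j) Γ_j - e_k`, where `e_k` is the elementary symmetric polynomial of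
degree `k` in `h̃_1, …, h̃_n`. -/
def c (k : ℕ) : Diff K n :=
  (∑ j : Fin n,
      ofU K n (algebraMap (MvPolynomial (Fin n) K) (Ubar K n) (pderiv j (esymm (Fin n) K k))) *
        Gam K j) -
    ofU K n (algebraMap (MvPolynomial (Fin n) K) (Ubar K n) (esymm (Fin n) K k))

variable {n} in
/-- The element `f` has weight `ω`, a linear form given by its values `ω i` on the `h̃_i`. -/
def HasWeight (ω : Fin n → K) (f : Diff K n) : Prop :=
  ∀ i : Fin n, ofU K n (ht K i) * f = f * (ofU K n (ht K i) + algebraMap K (Diff K n) (ω i))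

/-- The subring of the elements of weight zero. -/
def weightZero : Subring (Diff K n) where
  carrier := {f | HasWeight K 0 f}
  mul_mem' {a b} ha hb i := by
    have h1 := ha i
    have h2 := hb i
    simp only [Pi.zero_apply, map_zero, add_zero] at h1 h2 ⊢
    rw [← mul_assoc, h1, mul_assoc, h2, mul_assoc]
  one_mem' i := by simp
  add_mem' {a b} ha hb i := by
    have h1 := ha i
    have h2 := hb i
    simp only [Pi.zero_apply, map_zero, add_zero] at h1 h2 ⊢
    rw [mul_add, add_mul, h1, h2]
  zero_mem' i := by simp
  neg_mem' {a} ha i := by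
    have h1 := ha i
    simp only [Pi.zero_apply, map_zero, add_zero] at h1 ⊢
    rw [mul_neg, neg_mul, h1]

end Diff

end HDiff

end

/-! Wherever the `Γ_j` and `h̃_j` commute, the `c_k` are the coefficients of one polynomial in `s`:
`∑_{k=1}^n c_k s^(n-k) = ∑_j Γ_j ∏_{l≠j} (s + h̃_l) - ∏_l (s + h̃_l) + s^n`. At `s = -h̃_i` only
`Γ_i` survives, with coefficient `∏_{l≠i} (h̃_l - h̃_i)`, a unit of `Ū(n)`
(`sum_cpoly_mul_neg_pow`). So over `Ū(n)` the `Γ_j` and the `c_k` generate the same ring.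

Independence comes from the representation `rep` on the field of fractions of `Ū(n)[t_1, …, t_n]`.
There `x^i` and `∂̄_i` act by the shifts `h̃_i ↦ h̃_i ∓ 1` followed by multiplication by a function,
and `Γ_i` multiplies by `gam i`, the solution of the interpolation formula with `t_k` in place of
`c_k`; hence `c_k` acts as multiplication by `t_k` (`rep_c`). Faithfulness of `rep` on the whole
ring is not needed: the relations show that certain coefficients exist, and `rep` then identifies
them (`Gam_mul_Gam`, `letter_mul_evalC`).

For weight zero, the letters `x^i`, `∂̄_i` with distinct indices commute up to factors from `Ū(n)`,
and opposite letters with the same index multiply into the subring generated by `Ū(n)` and the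
`Γ_j`. Pairing letters puts every word of weight zero in that subring (`word_mem`), and a weight
decomposition extends this to all elements of weight zero (`weightZero_le`). Thus `evalC` is
bijective.

A letter passes `evalC p` by shifting the coefficients of `p`, so the `c_k` are central. Conversely,
a central element has weight zero and coefficients invariant under integer translations; in
characteristic zero these are constants (`eq_algebraMap_of_shift`). -/

noncomputable section

namespace HDiff

open MvPolynomial

universe u

/-! ### Generating functions of elementary symmetric polynomials and of the `c_k`. -/

section Vieta

variable (K : Type u) [Field K] (n : ℕ)

theorem pderiv_prod_X_add_C_of_notMem {σ : Type*} {R : Type*} [CommRing R] {s : Finset σ} {j : σ}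
    (hj : j ∉ s) (a : R) : pderiv j (∏ l ∈ s, (C a + X l : MvPolynomial σ R)) = 0 := by
  classical
  induction s using Finset.induction_on with
  | empty => simp
  | insert b t hb ih =>
    have hjb : b ≠ j := fun h => hj (by simp [h])
    have hjt : j ∉ t := fun h => hj (by simp [h])
    rw [Finset.prod_insert hb, Derivation.leibniz, ih hjt]
    simp [pderiv_X_of_ne hjb]

theorem sum_esymm_mul_pow {A : Type*} [CommRing A] [Algebra K A] (h : Fin n → A) (s : A) :
    ∑ k ∈ Finset.range (n + 1), aeval h (esymm (Fin n) K k) * s ^ (n - k) = ∏ l, (s + h l) := by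
  have key := congrArg (Polynomial.eval₂ (aeval h : MvPolynomial (Fin n) K →ₐ[K] A).toRingHom s)
    (MvPolynomial.prod_C_add_X_eq_sum_esymm K (Fin n))
  simpa [Polynomial.eval₂_finsetProd, Polynomial.eval₂_finsetSum] using key.symm

/-- This is the derivative of Vieta's identity. Since `pderiv j` must treat `s` as a constant, the
identity is checked at the infinitely many scalars `s = C a`, which gives an identity of polynomials
in `s` that specialises to `A`. -/
theorem sum_pderiv_esymm_mul_pow [Infinite K] {A : Type*} [CommRing A] [Algebra K A]
    (h : Fin n → A) (s : A) (j : Fin n) :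
    ∑ k ∈ Finset.range (n + 1), aeval h (pderiv j (esymm (Fin n) K k)) * s ^ (n - k) =
      ∏ l ∈ Finset.univ.erase j, (s + h l) := by
  have key : (∑ k ∈ Finset.range (n + 1),
      Polynomial.C (pderiv j (esymm (Fin n) K k)) * Polynomial.X ^ (n - k) :
        Polynomial (MvPolynomial (Fin n) K)) =
      ∏ l ∈ Finset.univ.erase j, (Polynomial.X + Polynomial.C (X l)) := by
    refine Polynomial.eq_of_infinite_eval_eq _ _ (Set.Infinite.mono (s := Set.range C) ?_
      (Set.infinite_range_of_injective (C_injective (Fin n) K)))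
    rintro _ ⟨a, rfl⟩
    have e := congrArg (pderiv j)
      (sum_esymm_mul_pow K n (X : Fin n → MvPolynomial (Fin n) K) (C a))
    rw [← Finset.mul_prod_erase _ _ (Finset.mem_univ j), Derivation.leibniz,
      pderiv_prod_X_add_C_of_notMem (Finset.notMem_erase j _)] at e
    have e2 : ∀ k m : ℕ, pderiv j (esymm (Fin n) K k * C a ^ m) =
        pderiv j (esymm (Fin n) K k) * C a ^ m := fun k m => by
      rw [← map_pow, mul_comm, pderiv_C_mul, mul_comm]
    simp only [aeval_X_left, AlgHom.id_apply, map_sum, e2] at e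
    simp only [Polynomial.eval_finsetSum, Polynomial.eval_prod, Polynomial.eval_mul,
      Polynomial.eval_C, Polynomial.eval_pow, Polynomial.eval_X, Polynomial.eval_add,
      Set.mem_ofPred_eq]
    rw [e]
    simp
  have key := congrArg (Polynomial.eval₂ (aeval h : MvPolynomial (Fin n) K →ₐ[K] A).toRingHom s)
    key
  simpa [Polynomial.eval₂_finsetProd, Polynomial.eval₂_finsetSum] using key

/-- The elements `∑_j (∂e_k/∂h_j) G_j - e_k` of a commutative algebra. -/
def cpoly {A : Type*} [CommRing A] [Algebra K A] (h G : Fin n → A) (k : ℕ) : A :=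
  (∑ j, aeval h (pderiv j (esymm (Fin n) K k)) * G j) - aeval h (esymm (Fin n) K k)

/-- The generating function of the elements `∑_j (∂e_k/∂h_j) G_j - e_k`. -/
theorem sum_cpoly_mul_pow [Infinite K] {A : Type*} [CommRing A] [Algebra K A]
    (h G : Fin n → A) (s : A) :
    ∑ k : Fin n, cpoly K n h G (k + 1) * s ^ (n - (k + 1)) =
      (∑ j, (∏ l ∈ Finset.univ.erase j, (s + h l)) * G j) - ∏ l, (s + h l) + s ^ n := by
  -- Since `e_0 = 1` has zero derivative, the term `k = 0` is `-s^n`; dropping it produces the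
  -- summand `s^n` on the right.
  have h0 : cpoly K n h G 0 = -1 := by simp [cpoly]
  have h1 : ∑ k ∈ Finset.range (n + 1), cpoly K n h G k * s ^ (n - k) =
      (∑ j, (∏ l ∈ Finset.univ.erase j, (s + h l)) * G j) - ∏ l, (s + h l) := by
    simp_rw [← sum_esymm_mul_pow K n h s, ← sum_pderiv_esymm_mul_pow K n h s, cpoly, sub_mul,
      Finset.sum_sub_distrib, Finset.sum_mul]
    rw [Finset.sum_comm]
    congr 1
    refine Finset.sum_congr rfl fun j _ => Finset.sum_congr rfl fun k _ => by ring
  rw [Finset.sum_range_succ', h0] at h1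
  rw [Fin.sum_univ_eq_sum_range (fun k => cpoly K n h G (k + 1) * s ^ (n - (k + 1))), ← h1]
  simp

/-- At `s = -h i` every product containing the factor `s + h i` vanishes. This Lagrange
interpolation is used twice: to define `gam` in the field, and to recover `Γ_i` from the `c_k` in
the ring. -/
theorem sum_cpoly_mul_neg_pow [Infinite K] {A : Type*} [CommRing A] [Algebra K A]
    (h G : Fin n → A) (i : Fin n) :
    ∑ k : Fin n, cpoly K n h G (k + 1) * (-h i) ^ (n - (k + 1)) =
      (∏ l ∈ Finset.univ.erase i, (h l - h i)) * G i + (-h i) ^ n := by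
  rw [sum_cpoly_mul_pow, Finset.prod_eq_zero (Finset.mem_univ i) (by ring),
    Finset.sum_eq_single i]
  · simp [neg_add_eq_sub]
  · intro j _ hj
    rw [Finset.prod_eq_zero (i := i) (by simp [Ne.symm hj]) (by ring), zero_mul]
  · simp

end Vieta

/-! ### Integer translations of `Ū(n)` and of the field of fractions, and shift operators. -/

section Shift

variable (K : Type u) [Field K] (n : ℕ)

variable {n} in
/-- The automorphism `h̃_j ↦ h̃_j - v_j` of the polynomial ring. -/
def polyShift (v : Fin n → ℤ) : MvPolynomial (Fin n) K →ₐ[K] MvPolynomial (Fin n) K :=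
  aeval fun j => X j - C ((v j : ℤ) : K)

variable {n} in
theorem polyShift_X (v : Fin n → ℤ) (j : Fin n) :
    polyShift K v (X j) = X j - C ((v j : ℤ) : K) := by simp [polyShift]

variable {n} in
theorem denominators_le_comap (v : Fin n → ℤ) :
    denominators K n ≤ (denominators K n).comap (polyShift K v) := by
  refine Submonoid.closure_le.2 ?_
  rintro _ ⟨i, j, hij, k, rfl⟩
  refine Submonoid.subset_closure ⟨i, j, hij, k - v i + v j, ?_⟩
  rw [map_add, map_sub, polyShift_X, polyShift_X, algHom_C]
  simp
  ring

variable {n} in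
/-- The automorphism `h̃_j ↦ h̃_j - v_j` of `Ū(n)`. -/
def shift (v : Fin n → ℤ) : Ubar K n →+* Ubar K n :=
  IsLocalization.map (Ubar K n) (polyShift K v).toRingHom (denominators_le_comap K v)

variable {n}

theorem shift_algebraMap (v : Fin n → ℤ) (p : MvPolynomial (Fin n) K) :
    shift K v (algebraMap _ (Ubar K n) p) = algebraMap _ (Ubar K n) (polyShift K v p) :=
  IsLocalization.map_eq _ _

theorem shift_ht (v : Fin n → ℤ) (j : Fin n) : shift K v (ht K j) = ht K j - (v j : Ubar K n) := by
  rw [ht, shift_algebraMap, polyShift_X, map_sub]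
  simp

theorem shift_C (v : Fin n → ℤ) (a : K) :
    shift K v (algebraMap K (Ubar K n) a) = algebraMap K (Ubar K n) a := by
  rw [IsScalarTower.algebraMap_apply K (MvPolynomial (Fin n) K) (Ubar K n), shift_algebraMap,
    AlgHom.commutes]

variable {K} in
theorem Ubar_ringHom_ext {B : Type*} [Semiring B] {f g : Ubar K n →+* B}
    (hC : ∀ a : K, f (algebraMap K (Ubar K n) a) = g (algebraMap K (Ubar K n) a))
    (hX : ∀ i, f (ht K i) = g (ht K i)) : f = g := by
  refine IsLocalization.ringHom_ext (denominators K n) (MvPolynomial.ringHom_ext ?_ hX)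
  intro a
  exact hC a

theorem shift_add (v w : Fin n → ℤ) : shift K (v + w) = (shift K v).comp (shift K w) := by
  refine Ubar_ringHom_ext (fun a => by simp [shift_C]) fun i => ?_
  simp [shift_ht]
  ring

theorem shift_zero : shift K (0 : Fin n → ℤ) = RingHom.id _ := by
  refine Ubar_ringHom_ext (fun a => by simp [shift_C]) fun i => ?_
  simp [shift_ht]

theorem shift_shift (v w : Fin n → ℤ) (f : Ubar K n) :
    shift K v (shift K w f) = shift K (v + w) f := by rw [shift_add]; rfl

theorem shift_neg_shift (v : Fin n → ℤ) (f : Ubar K n) : shift K (-v) (shift K v f) = f := by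
  rw [shift_shift, neg_add_cancel, shift_zero]; rfl

theorem shift_injective (v : Fin n → ℤ) : Function.Injective (shift K v) :=
  Function.LeftInverse.injective (shift_neg_shift K v)

variable (n)

theorem denominators_le_nonZeroDivisors :
    denominators K n ≤ nonZeroDivisors (MvPolynomial (Fin n) K) := by
  refine Submonoid.closure_le.2 ?_
  rintro _ ⟨i, j, hij, k, rfl⟩
  refine mem_nonZeroDivisors_of_ne_zero fun h => ?_
  -- A generator of the denominators has derivative `1` with respect to `X i`, so it is nonzero in
  -- any characteristic.
  have h1 := congrArg (pderiv i) h
  simp [pderiv_X_of_ne hij.symm] at h1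

instance : IsDomain (Ubar K n) :=
  IsLocalization.isDomain_localization (denominators_le_nonZeroDivisors K n)

theorem Ubar_algebraMap_injective :
    Function.Injective (algebraMap (MvPolynomial (Fin n) K) (Ubar K n)) :=
  IsLocalization.injective _ (denominators_le_nonZeroDivisors K n)

/-- The field of fractions of `Ū(n)[t_1, …, t_n]`. -/
def Fld : Type u := FractionRing (MvPolynomial (Fin n) (Ubar K n))

instance : Field (Fld K n) :=
  inferInstanceAs (Field (FractionRing (MvPolynomial (Fin n) (Ubar K n))))

instance : Algebra (MvPolynomial (Fin n) (Ubar K n)) (Fld K n) :=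
  inferInstanceAs (Algebra _ (FractionRing (MvPolynomial (Fin n) (Ubar K n))))

instance : IsFractionRing (MvPolynomial (Fin n) (Ubar K n)) (Fld K n) :=
  inferInstanceAs (IsFractionRing _ (FractionRing (MvPolynomial (Fin n) (Ubar K n))))

instance : Algebra K (Fld K n) :=
  ((algebraMap (MvPolynomial (Fin n) (Ubar K n)) (Fld K n)).comp
    (algebraMap K (MvPolynomial (Fin n) (Ubar K n)))).toAlgebra

/-- The inclusion of `Ū(n)[t_1, …, t_n]` in its field of fractions. -/
def toFld : MvPolynomial (Fin n) (Ubar K n) →+* Fld K n :=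
  algebraMap _ _

theorem toFld_injective : Function.Injective (toFld K n) := IsFractionRing.injective (MvPolynomial (Fin n) (Ubar K n)) (Fld K n)

variable {n}

/-- The element `h̃_i` of the field of fractions. -/
def H (i : Fin n) : Fld K n := toFld K n (C (ht K i))

/-- The variable `t_i` in the field of fractions. -/
def t (i : Fin n) : Fld K n := toFld K n (X i)

theorem Fld_algebraMap (a : K) :
    algebraMap K (Fld K n) a = toFld K n (C (algebraMap K (Ubar K n) a)) := by
  rw [← MvPolynomial.algebraMap_apply]
  rfl

theorem Fld_hom_ext {f g : Fld K n →+* Fld K n}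
    (hC : ∀ a : K, f (algebraMap K (Fld K n) a) = g (algebraMap K (Fld K n) a))
    (hH : ∀ i, f (H K i) = g (H K i)) (ht : ∀ i, f (t K i) = g (t K i)) : f = g := by
  refine IsFractionRing.ringHom_ext (A := MvPolynomial (Fin n) (Ubar K n)) fun p => ?_
  have : (f.comp (toFld K n)) = g.comp (toFld K n) := by
    refine MvPolynomial.ringHom_ext' (Ubar_ringHom_ext (fun a => ?_) hH) ht
    simpa [Fld_algebraMap] using hC a
  exact RingHom.congr_fun this p

/-- The automorphism `h̃_j ↦ h̃_j - v_j` of the field of fractions. -/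
def fldShift (v : Fin n → ℤ) : Fld K n →+* Fld K n :=
  IsFractionRing.map (A := MvPolynomial (Fin n) (Ubar K n)) (B := MvPolynomial (Fin n) (Ubar K n))
    (j := map (shift K v)) (map_injective (σ := Fin n) (shift K v) (shift_injective K v))

theorem fldShift_toFld (v : Fin n → ℤ) (p : MvPolynomial (Fin n) (Ubar K n)) :
    fldShift K v (toFld K n p) = toFld K n (map (shift K v) p) := by
  simp [fldShift, toFld, IsFractionRing.map]

theorem fldShift_H (v : Fin n → ℤ) (i : Fin n) :
    fldShift K v (H K i) = H K i - (v i : Fld K n) := by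
  rw [H, fldShift_toFld, map_C, shift_ht]
  simp

theorem fldShift_t (v : Fin n → ℤ) (i : Fin n) : fldShift K v (t K i) = t K i := by
  rw [t, fldShift_toFld, map_X]

theorem fldShift_algebraMap (v : Fin n → ℤ) (a : K) :
    fldShift K v (algebraMap K (Fld K n) a) = algebraMap K (Fld K n) a := by
  rw [Fld_algebraMap, fldShift_toFld, map_C, shift_C]

theorem fldShift_add (v w : Fin n → ℤ) (f : Fld K n) :
    fldShift K (v + w) f = fldShift K v (fldShift K w f) := by
  have : fldShift K (v + w) = (fldShift K v).comp (fldShift K w) :=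
    Fld_hom_ext K (fun a => by simp [fldShift_algebraMap])
      (fun i => by simp [fldShift_H]; ring) fun i => by simp [fldShift_t]
  rw [this]; rfl

theorem fldShift_zero (f : Fld K n) : fldShift K 0 f = f := by
  have : fldShift K (0 : Fin n → ℤ) = RingHom.id _ :=
    Fld_hom_ext K (fun a => by simp [fldShift_algebraMap])
      (fun i => by simp [fldShift_H]) fun i => by simp [fldShift_t]
  rw [this]; rfl

/-- The operator `g ↦ f σ_v(g)` on the field of fractions, where `σ_v` is the shift by `v`. -/
def op (f : Fld K n) (v : Fin n → ℤ) : Module.End K (Fld K n) where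
  toFun g := f * fldShift K v g
  map_add' a b := by rw [map_add, mul_add]
  map_smul' a g := by
    rw [Algebra.smul_def, map_mul, fldShift_algebraMap, RingHom.id_apply, Algebra.smul_def,
      mul_left_comm]

theorem op_apply (f : Fld K n) (v : Fin n → ℤ) (g : Fld K n) :
    op K f v g = f * fldShift K v g := rfl

theorem op_mul_op (f g : Fld K n) (v w : Fin n → ℤ) :
    op K f v * op K g w = op K (f * fldShift K v g) (v + w) := by
  ext a
  simp [op_apply, fldShift_add, mul_assoc]

theorem op_add (f g : Fld K n) (v : Fin n → ℤ) : op K (f + g) v = op K f v + op K g v := by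
  ext a
  simp [op_apply, add_mul]

theorem op_algebraMap (a : K) :
    op K (algebraMap K (Fld K n) a) 0 = algebraMap K (Module.End K (Fld K n)) a := by
  ext g
  simp [op_apply, fldShift_zero, Algebra.smul_def]

end Shift

/-! ### The representation of `Diff_h(n)` by shift operators. -/

section Representation

variable (K : Type u) [Field K] {n : ℕ}

theorem H_sub_add_int_ne_zero {i j : Fin n} (hij : i ≠ j) (m : ℤ) :
    H K i - H K j + (m : Fld K n) ≠ 0 := by
  have h := ((isUnit_hd_add_int K hij m).map ((toFld K n).comp C)).ne_zero
  simpa [hd, H] using h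

theorem H_sub_ne_zero {i j : Fin n} (hij : i ≠ j) : H K i - H K j ≠ 0 := by
  simpa using H_sub_add_int_ne_zero K hij 0

theorem H_injective : Function.Injective (H K (n := n)) := fun i j h => by
  by_contra hij
  exact H_sub_ne_zero K hij (sub_eq_zero.2 h)

/-- The image of `Γ_i` in the field of fractions. -/
def gam (i : Fin n) : Fld K n :=
  (∑ k : Fin n, t K k * (-H K i) ^ (n - ((k : ℕ) + 1)) - (-H K i) ^ n) /
    ∏ l ∈ Finset.univ.erase i, (H K l - H K i)

/-- The coefficient of the operator representing `x^i`. -/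
def xCoeff (i : Fin n) : Fld K n := ∏ k with i < k, (H K i - H K k)⁻¹

/-- The shift of the inverse of the coefficient of the operator representing `x^i`. -/
def dCoeff (i : Fin n) : Fld K n := ∏ k with i < k, (H K i - H K k + 1)

theorem prod_erase_H_sub_ne_zero (i : Fin n) :
    ∏ l ∈ Finset.univ.erase i, (H K l - H K i) ≠ 0 :=
  Finset.prod_ne_zero_iff.2 fun _ hl => H_sub_ne_zero K (Finset.ne_of_mem_erase hl)

theorem prod_mul_gam (i : Fin n) :
    (∏ l ∈ Finset.univ.erase i, (H K l - H K i)) * gam K i =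
      ∑ k : Fin n, t K k * (-H K i) ^ (n - ((k : ℕ) + 1)) - (-H K i) ^ n :=
  mul_div_cancel₀ _ (prod_erase_H_sub_ne_zero K i)

/-- The two sides are coefficients of polynomials of degree less than `n` that agree at the `n`
distinct points `-H i`, so Vandermonde applies. Indices are reversed because the exponent `n - (k +
1)` decreases with `k`. -/
theorem cpoly_gam [Infinite K] (k : Fin n) : cpoly K n (H K) (gam K) (k + 1) = t K k := by
  have h := Matrix.eq_zero_of_forall_index_sum_mul_pow_eq_zero
    (f := fun i => -H K i)
    (v := fun k => cpoly K n (H K) (gam K) ((k.rev : ℕ) + 1) - t K k.rev)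
    (fun i j hij => H_injective K (neg_injective hij)) fun i => by
      have h1 := sum_cpoly_mul_neg_pow K n (H K) (gam K) i
      rw [prod_mul_gam, sub_add_cancel, ← sub_eq_zero, ← Finset.sum_sub_distrib] at h1
      rw [← h1, ← Equiv.sum_comp Fin.revPerm]
      refine Finset.sum_congr rfl fun k _ => ?_
      simp [Fin.val_rev, sub_mul]
  have h2 := congrFun h k.rev
  simpa [sub_eq_zero] using h2

theorem sum_t_mul_pow [Infinite K] (s : Fld K n) :
    ∑ k : Fin n, t K k * s ^ (n - ((k : ℕ) + 1)) =
      (∑ j, (∏ l ∈ Finset.univ.erase j, (s + H K l)) * gam K j) - ∏ l, (s + H K l) + s ^ n := by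
  rw [← sum_cpoly_mul_pow K]
  simp_rw [cpoly_gam]

/-- Shifting one variable alters a single factor of the products below; the cross-multiplied form
avoids division. -/
theorem prod_congr_off {ι M : Type*} [CommMonoid M] [DecidableEq ι] {s : Finset ι} {j : ι}
    (hj : j ∈ s) {f g : ι → M} {a b : M} (hab : f j * a = g j * b)
    (h : ∀ k ∈ s, k ≠ j → f k = g k) : (∏ k ∈ s, f k) * a = (∏ k ∈ s, g k) * b := by
  rw [← Finset.mul_prod_erase s f hj, ← Finset.mul_prod_erase s g hj, mul_right_comm, hab,
    mul_right_comm]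
  exact congrArg (g j * · * b) (Finset.prod_congr rfl fun k hk =>
    h k (Finset.mem_of_mem_erase hk) (Finset.ne_of_mem_erase hk))

/-- The weight of `x^i`. -/
def wt (i : Fin n) (m : ℤ) : Fin n → ℤ := Pi.single i m

theorem fldShift_wt_H (i j : Fin n) (m : ℤ) :
    fldShift K (wt i m) (H K j) = H K j - if i = j then (m : Fld K n) else 0 := by
  rw [fldShift_H, wt, Pi.single_apply]
  simp only [eq_comm (a := j)]
  split_ifs <;> simp

theorem fldShift_xCoeff_of_lt {i j : Fin n} (hij : i < j) (m : ℤ) :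
    fldShift K (wt i m) (xCoeff K j) = xCoeff K j := by
  simp only [xCoeff, map_prod, map_inv₀, map_sub, fldShift_wt_H]
  refine Finset.prod_congr rfl fun k hk => ?_
  have hk : j < k := by simpa using hk
  simp [hij.ne, (hij.trans hk).ne]

theorem fldShift_dCoeff_of_lt {i j : Fin n} (hij : i < j) (m : ℤ) :
    fldShift K (wt i m) (dCoeff K j) = dCoeff K j := by
  simp only [dCoeff, map_prod, map_add, map_one, map_sub, fldShift_wt_H]
  refine Finset.prod_congr rfl fun k hk => ?_
  have hk : j < k := by simpa using hk
  simp [hij.ne, (hij.trans hk).ne]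

theorem fldShift_xCoeff_of_gt {i j : Fin n} (hij : i < j) (m : ℤ) :
    fldShift K (wt j m) (xCoeff K i) * (H K i - H K j + m) = xCoeff K i * (H K i - H K j) := by
  simp only [xCoeff, map_prod, map_inv₀, map_sub, fldShift_wt_H]
  refine prod_congr_off (j := j) (by simpa using hij) ?_ fun k _ hkj => ?_
  · simp only [hij.ne', if_true, if_false]
    rw [inv_mul_cancel₀ (H_sub_ne_zero K hij.ne), sub_zero, sub_sub_eq_add_sub,
      add_sub_right_comm, inv_mul_cancel₀ (H_sub_add_int_ne_zero K hij.ne m)]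
  · simp [hij.ne', hkj.symm]

theorem fldShift_dCoeff_of_gt {i j : Fin n} (hij : i < j) (m : ℤ) :
    fldShift K (wt j m) (dCoeff K i) * (H K i - H K j + 1) =
      dCoeff K i * (H K i - H K j + m + 1) := by
  simp only [dCoeff, map_prod, map_add, map_one, map_sub, fldShift_wt_H]
  refine prod_congr_off (j := j) (by simpa using hij) ?_ fun k _ hkj => ?_
  · simp only [hij.ne', if_true, if_false]
    ring
  · simp [hij.ne', hkj.symm]

/-- The numerator of `gam j` involves only `H j` and the `t k`, so the shift of `H i` changes just
one factor of the denominator. -/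
theorem fldShift_gam_of_ne {i j : Fin n} (hij : i ≠ j) (m : ℤ) :
    fldShift K (wt i m) (gam K j) * (H K i - H K j - m) = gam K j * (H K i - H K j) := by
  have hne : H K i - H K j - m ≠ 0 := by
    simpa [sub_eq_add_neg] using H_sub_add_int_ne_zero K hij (-m)
  have h1 : fldShift K (wt i m) (∏ l ∈ Finset.univ.erase j, (H K l - H K j)) * (H K i - H K j) =
      (∏ l ∈ Finset.univ.erase j, (H K l - H K j)) * (H K i - H K j - m) := by
    simp only [map_prod, map_sub, fldShift_wt_H]
    refine prod_congr_off (j := i) (by simpa using hij) ?_ fun k _ hki => ?_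
    · simp only [hij, if_true, if_false]
      ring
    · simp [hij, hki.symm]
  have h2 := congrArg (fldShift K (wt i m)) (prod_mul_gam K j)
  simp only [map_sub, map_sum, map_mul, map_pow, map_neg, fldShift_wt_H, fldShift_t, hij,
    if_false, sub_zero] at h2
  rw [← prod_mul_gam] at h2
  have h3 := prod_erase_H_sub_ne_zero K j
  refine mul_left_cancel₀ h3 ?_
  linear_combination (H K i - H K j) * h2 - (fldShift K (wt i m) (gam K j)) * h1

/-- The shift turns the interpolation point `-H i` into `1 - H i`, and the generating function
evaluated there is the right-hand side up to a common product. This is the relation for `x^i ∂̄_i`.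
-/
theorem fldShift_gam_self [Infinite K] (i : Fin n) :
    fldShift K (wt i 1) (gam K i) = ∑ j, (1 - (H K i - H K j))⁻¹ * gam K j - 1 := by
  have hne : ∀ j, 1 - H K i + H K j ≠ 0 := fun j => by
    by_cases hij : i = j
    · simp [hij]
    · have := H_sub_add_int_ne_zero K (Ne.symm hij) 1
      intro h
      apply this
      linear_combination h
  have h1 := congrArg (fldShift K (wt i 1)) (prod_mul_gam K i)
  simp only [map_sub, map_sum, map_mul, map_prod, map_pow, map_neg, fldShift_wt_H, fldShift_t,
    if_true, Int.cast_one, neg_sub] at h1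
  rw [sum_t_mul_pow, add_sub_cancel_right] at h1
  -- The factor `l = i` on the right equals `1`, so the product may run over all indices.
  have h2 : ∏ l ∈ Finset.univ.erase i, (H K l - (if i = l then 1 else 0) - (H K i - 1)) =
      ∏ l, (1 - H K i + H K l) := by
    rw [← Finset.mul_prod_erase _ _ (Finset.mem_univ i)]
    simp only [sub_add_cancel, one_mul]
    refine Finset.prod_congr rfl fun l hl => ?_
    rw [if_neg (Finset.ne_of_mem_erase hl).symm]
    ring
  rw [h2] at h1
  have h3 : ∏ l, (1 - H K i + H K l) ≠ 0 := Finset.prod_ne_zero_iff.2 fun l _ => hne l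
  refine mul_left_cancel₀ h3 ?_
  rw [h1, mul_sub, mul_one, Finset.mul_sum]
  congr 1
  refine Finset.sum_congr rfl fun j _ => ?_
  rw [← mul_assoc, ← Finset.mul_prod_erase _ _ (Finset.mem_univ j), sub_sub_eq_add_sub,
    add_sub_right_comm, mul_comm (1 - H K i + H K j), mul_assoc _ _ (_)⁻¹,
    mul_inv_cancel₀ (hne j), mul_one]

/-- With this normalisation the coefficients cancel in `∂̄_i x^i` and `x^i ∂̄_i`, leaving `gam i`
and its shift. -/
theorem xCoeff_mul_fldShift_dCoeff (i : Fin n) :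
    xCoeff K i * fldShift K (wt i 1) (dCoeff K i) = 1 := by
  simp only [xCoeff, dCoeff, map_prod, map_add, map_one, map_sub, fldShift_wt_H]
  rw [← Finset.prod_mul_distrib]
  refine Finset.prod_eq_one fun k hk => ?_
  have hk : i < k := by simpa using hk
  simp only [hk.ne, if_true, if_false, Int.cast_one]
  rw [sub_zero, sub_right_comm, sub_add_cancel, inv_mul_cancel₀ (H_sub_ne_zero K hk.ne)]

theorem dCoeff_mul_fldShift_xCoeff (i : Fin n) :
    dCoeff K i * fldShift K (wt i (-1)) (xCoeff K i) = 1 := by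
  have h := congrArg (fldShift K (wt i (-1))) (xCoeff_mul_fldShift_dCoeff K i)
  rw [map_mul, ← fldShift_add, wt, wt, ← Pi.single_add, map_one] at h
  simpa [fldShift_zero, mul_comm, wt] using h

theorem toFld_ringInverse {f : Ubar K n} (hf : IsUnit f) :
    toFld K n (C (Ring.inverse f)) = (toFld K n (C f))⁻¹ := by
  refine eq_inv_of_mul_eq_one_left ?_
  rw [← map_mul, ← map_mul, Ring.inverse_mul_cancel _ hf, map_one, map_one]

theorem toFld_hd (i j : Fin n) : toFld K n (C (hd K i j)) = H K i - H K j := by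
  simp [hd, H]

theorem toFld_C_ht (i : Fin n) : toFld K n (C (ht K i)) = H K i := rfl

theorem wt_add_wt_neg (i : Fin n) : wt i 1 + wt i (-1) = 0 := by
  rw [wt, wt, ← Pi.single_add, add_neg_cancel, Pi.single_zero]

theorem op_mul_op_wt (f g : Fld K n) (i : Fin n) :
    op K f (wt i (-1)) * op K g (wt i 1) = op K (f * fldShift K (wt i (-1)) g) 0 := by
  rw [op_mul_op, add_comm, wt_add_wt_neg]

theorem op_one_zero : op K (1 : Fld K n) 0 = 1 := by
  ext g
  simp [op_apply, fldShift_zero]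

theorem op_zero_zero : op K (0 : Fld K n) 0 = 0 := by
  ext g
  simp [op_apply]

/-- Multiplication operators on the field of fractions. -/
def opHom : Fld K n →+* Module.End K (Fld K n) where
  toFun f := op K f 0
  map_one' := op_one_zero K
  map_mul' f g := by rw [op_mul_op, fldShift_zero, zero_add]
  map_zero' := op_zero_zero K
  map_add' f g := op_add K f g 0

theorem opHom_mul_op (f g : Fld K n) (v : Fin n → ℤ) :
    opHom K f * op K g v = op K (f * g) v := by
  change op K f 0 * _ = _
  rw [op_mul_op, fldShift_zero, zero_add]

theorem op_mul_opHom (f g : Fld K n) (v : Fin n → ℤ) :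
    op K f v * opHom K g = op K (f * fldShift K v g) v := by
  change _ * op K g 0 = _
  rw [op_mul_op, add_zero]

theorem op_zero_eq (f : Fld K n) : op K f 0 = opHom K f := rfl

/-- The operators representing the generators. -/
def repGen : Gen K n → Module.End K (Fld K n)
  | .coeff f => opHom K (toFld K n (C f))
  | .x i => op K (xCoeff K i) (wt i 1)
  | .d i => op K (gam K i * dCoeff K i) (wt i (-1))

/-- For `i < j` the difference `H i - H j` occurs in `xCoeff i` but not in `xCoeff j`; this
asymmetry produces the factor in the relation. -/
theorem repGen_x_x {i j : Fin n} (hij : i < j) :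
    xCoeff K i * fldShift K (wt i 1) (xCoeff K j) =
      (H K i - H K j + 1) * (H K i - H K j)⁻¹ *
        (xCoeff K j * fldShift K (wt j 1) (xCoeff K i)) := by
  have h1 := H_sub_ne_zero K hij.ne
  have h2 : H K i - H K j + 1 ≠ 0 := by simpa using H_sub_add_int_ne_zero K hij.ne 1
  have e1 := fldShift_xCoeff_of_gt K hij 1
  rw [Int.cast_one, ← eq_div_iff h2] at e1
  rw [e1, fldShift_xCoeff_of_lt K hij]
  field_simp

theorem repGen_d_d {i j : Fin n} (hij : i < j) :
    gam K i * dCoeff K i * fldShift K (wt i (-1)) (gam K j * dCoeff K j) =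
      (H K i - H K j - 1) * (H K i - H K j)⁻¹ *
        (gam K j * dCoeff K j * fldShift K (wt j (-1)) (gam K i * dCoeff K i)) := by
  have h1 := H_sub_ne_zero K hij.ne
  have h2 : H K i - H K j + 1 ≠ 0 := by simpa using H_sub_add_int_ne_zero K hij.ne 1
  have h3 : H K i - H K j - 1 ≠ 0 := by
    simpa [sub_eq_add_neg] using H_sub_add_int_ne_zero K hij.ne (-1)
  have e1 := fldShift_gam_of_ne K hij.ne (-1)
  have e2 := fldShift_gam_of_ne K hij.ne' (-1)
  have e3 := fldShift_dCoeff_of_gt K hij (-1)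
  push_cast at e1 e2 e3
  rw [sub_neg_eq_add, ← eq_div_iff h2] at e1
  rw [neg_add_cancel_right, ← eq_div_iff h2] at e3
  have e2 : fldShift K (wt j (-1)) (gam K i) =
      gam K i * (H K i - H K j) / (H K i - H K j - 1) := by
    rw [eq_div_iff h3]
    linear_combination -e2
  rw [map_mul, map_mul, e1, e2, e3, fldShift_dCoeff_of_lt K hij]
  field_simp

theorem repGen_x_d_lt {i j : Fin n} (hij : i < j) :
    xCoeff K i * fldShift K (wt i 1) (gam K j * dCoeff K j) =
      gam K j * dCoeff K j * fldShift K (wt j (-1)) (xCoeff K i) := by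
  have h3 : H K i - H K j - 1 ≠ 0 := by
    simpa [sub_eq_add_neg] using H_sub_add_int_ne_zero K hij.ne (-1)
  have e1 := fldShift_gam_of_ne K hij.ne 1
  have e2 := fldShift_xCoeff_of_gt K hij (-1)
  push_cast at e1 e2
  rw [← eq_div_iff h3] at e1
  rw [← sub_eq_add_neg, ← eq_div_iff h3] at e2
  rw [map_mul, e1, e2, fldShift_dCoeff_of_lt K hij]
  field_simp

/-- Writing `h` for `H i - H j`, the shift multiplies `gam j` by `h / (h - 1)` and `dCoeff j` by `(h
- 2) / (h - 1)`. -/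
theorem repGen_x_d_gt {i j : Fin n} (hij : j < i) :
    xCoeff K i * fldShift K (wt i 1) (gam K j * dCoeff K j) =
      (H K i - H K j) * (H K i - H K j - 2) * ((H K i - H K j - 1) ^ 2)⁻¹ *
        (gam K j * dCoeff K j * fldShift K (wt j (-1)) (xCoeff K i)) := by
  have h3 : H K i - H K j - 1 ≠ 0 := by
    simpa [sub_eq_add_neg] using H_sub_add_int_ne_zero K hij.ne' (-1)
  have e1 := fldShift_gam_of_ne K hij.ne' 1
  have e2 := fldShift_dCoeff_of_gt K hij 1
  push_cast at e1 e2
  rw [← eq_div_iff h3] at e1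
  have e2 : fldShift K (wt i 1) (dCoeff K j) =
      dCoeff K j * (H K i - H K j - 2) / (H K i - H K j - 1) := by
    rw [eq_div_iff h3]
    linear_combination -e2
  rw [map_mul, e1, e2, fldShift_xCoeff_of_lt K hij]
  field_simp

theorem repGen_x_d_self [Infinite K] (i : Fin n) :
    xCoeff K i * fldShift K (wt i 1) (gam K i * dCoeff K i) =
      ∑ j, (1 - (H K i - H K j))⁻¹ * gam K j - 1 := by
  rw [map_mul, mul_left_comm, xCoeff_mul_fldShift_dCoeff, mul_one, fldShift_gam_self]

theorem repGen_d_x (i : Fin n) :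
    gam K i * dCoeff K i * fldShift K (wt i (-1)) (xCoeff K i) = gam K i := by
  rw [mul_assoc, dCoeff_mul_fldShift_xCoeff, mul_one]

theorem repGen_rel [Infinite K] {a b : FreeAlgebra K (Gen K n)} (h : Rel K n a b) :
    FreeAlgebra.lift K (repGen K) a = FreeAlgebra.lift K (repGen K) b := by
  induction h with
  | coeff_add f g => simp [fU, repGen]
  | coeff_mul f g => simp [fU, repGen]
  | coeff_algebraMap a =>
    rw [AlgHom.commutes, ← op_algebraMap, Fld_algebraMap]
    simp [fU, repGen, op_zero_eq]
  | weight_x i j =>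
    rw [map_mul, map_mul]
    simp only [fU, fx, FreeAlgebra.lift_ι_apply, repGen]
    rw [opHom_mul_op, op_mul_opHom, mul_comm, map_add, map_add, map_add, toFld_C_ht]
    by_cases hij : i = j
    · simp [hij, fldShift_wt_H]
    · simp [hij, Ne.symm hij, fldShift_wt_H]
  | weight_d i j =>
    rw [map_mul, map_mul]
    simp only [fU, fd, FreeAlgebra.lift_ι_apply, repGen]
    rw [opHom_mul_op, op_mul_opHom, mul_comm, map_sub, map_sub, map_sub, toFld_C_ht]
    by_cases hij : i = j
    · simp [hij, fldShift_wt_H]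
    · simp [hij, Ne.symm hij, fldShift_wt_H]
  | x_x i j hij =>
    rw [map_mul, map_mul, map_mul]
    simp only [fU, fx, FreeAlgebra.lift_ι_apply, repGen]
    rw [op_mul_op, op_mul_op, opHom_mul_op, repGen_x_x K hij, add_comm (wt i 1), map_mul, map_mul,
      toFld_ringInverse K (isUnit_hd K hij.ne)]
    simp only [map_add, map_one, toFld_hd]
  | d_d i j hij =>
    rw [map_mul, map_mul, map_mul]
    simp only [fU, fd, FreeAlgebra.lift_ι_apply, repGen]
    rw [op_mul_op, op_mul_op, opHom_mul_op, repGen_d_d K hij, add_comm (wt i (-1)), C_mul,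
      map_mul (toFld K n), toFld_ringInverse K (isUnit_hd K hij.ne)]
    simp only [map_sub, map_one, toFld_hd]
  | x_d_lt i j hij =>
    rw [map_mul, map_mul]
    simp only [fx, fd, FreeAlgebra.lift_ι_apply, repGen]
    rw [op_mul_op, op_mul_op, repGen_x_d_lt K hij, add_comm (wt i 1)]
  | x_d_gt i j hij =>
    rw [map_mul, map_mul, map_mul]
    simp only [fU, fx, fd, FreeAlgebra.lift_ι_apply, repGen]
    rw [op_mul_op, op_mul_op, opHom_mul_op, repGen_x_d_gt K hij, add_comm (wt i 1), map_mul,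
      map_mul, toFld_ringInverse K ((isUnit_hd_sub_one K hij.ne').pow 2)]
    simp only [map_sub, map_mul, map_pow, map_ofNat, map_one, toFld_hd]
  | x_d_self i =>
    rw [map_mul, map_sub, map_sum, map_one]
    simp only [map_mul, fU, fx, fd, FreeAlgebra.lift_ι_apply, repGen, op_mul_op_wt, repGen_d_x]
    rw [op_mul_op, wt_add_wt_neg, repGen_x_d_self, op_zero_eq, map_sub, map_sum, map_one]
    simp only [op_zero_eq, map_mul, toFld_ringInverse K (isUnit_one_sub_hd K _ _), map_sub,
      map_one, toFld_hd]

theorem toFld_C_algebraMap (p : MvPolynomial (Fin n) K) :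
    toFld K n (C (algebraMap _ (Ubar K n) p)) = aeval (H K) p := by
  have : ((toFld K n).comp C).comp (algebraMap (MvPolynomial (Fin n) K) (Ubar K n)) =
      (aeval (H K) : MvPolynomial (Fin n) K →ₐ[K] Fld K n).toRingHom := by
    refine MvPolynomial.ringHom_ext (fun a => ?_) fun i => ?_
    · simp [Fld_algebraMap]
      rfl
    · simp [H, ht]
  exact RingHom.congr_fun this p

/-- The representation of `Diff_h(n)` by operators on the field of fractions. -/
def rep [Infinite K] : Diff K n →ₐ[K] Module.End K (Fld K n) :=
  RingQuot.liftAlgHom K ⟨FreeAlgebra.lift K (repGen K), fun _ _ h => repGen_rel K h⟩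

variable [Infinite K]

theorem rep_proj (a : FreeAlgebra K (Gen K n)) :
    rep K (proj K n a) = FreeAlgebra.lift K (repGen K) a :=
  RingQuot.liftAlgHom_mkAlgHom_apply K _ _ _

theorem rep_ofU (f : Ubar K n) : rep K (ofU K n f) = opHom K (toFld K n (C f)) := by
  change rep K (proj K n (fU K n f)) = _
  rw [rep_proj, fU, FreeAlgebra.lift_ι_apply, repGen]

theorem rep_x (i : Fin n) : rep K (x K i) = op K (xCoeff K i) (wt i 1) := by
  rw [x, rep_proj, fx, FreeAlgebra.lift_ι_apply, repGen]

theorem rep_d (i : Fin n) : rep K (d K i) = op K (gam K i * dCoeff K i) (wt i (-1)) := by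
  rw [d, rep_proj, fd, FreeAlgebra.lift_ι_apply, repGen]

theorem rep_Gam (i : Fin n) : rep K (Gam K i) = opHom K (gam K i) := by
  rw [Gam, map_mul, rep_x, rep_d, op_mul_op_wt, repGen_d_x, op_zero_eq]

theorem rep_c (k : Fin n) : rep K (c K n (k + 1)) = opHom K (t K k) := by
  rw [← cpoly_gam, c, cpoly, map_sub, map_sum, map_sub, map_sum]
  simp only [map_mul, rep_ofU, rep_Gam, toFld_C_algebraMap]

end Representation

/-! ### Words in the letters, and the weight zero subring as the ring generated by `Ū(n)` and the
`Γ_j`. -/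

section WeightZero

variable (K : Type u) [Field K] {n : ℕ}

/-- The rule passes from the `h̃_i` to polynomials, and then to fractions because denominators
become units. -/
theorem mul_ofU_of_mul_ht {z : Diff K n} {v : Fin n → ℤ}
    (hz : ∀ i, z * ofU K n (ht K i) = ofU K n (shift K v (ht K i)) * z) (f : Ubar K n) :
    z * ofU K n f = ofU K n (shift K v f) * z := by
  have hp : ∀ p : MvPolynomial (Fin n) K, z * ofU K n (algebraMap _ (Ubar K n) p) =
      ofU K n (shift K v (algebraMap _ (Ubar K n) p)) * z := fun p => by
    induction p using MvPolynomial.induction_on with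
    | C a =>
      rw [← MvPolynomial.algebraMap_eq, ← IsScalarTower.algebraMap_apply, shift_C,
        AlgHom.commutes, Algebra.commutes]
    | add p q hp hq => simp only [map_add, mul_add, add_mul, hp, hq]
    | mul_X p i hp =>
      rw [map_mul, map_mul, map_mul, map_mul, ← mul_assoc, hp, mul_assoc, mul_assoc]
      exact congrArg _ (hz i)
  obtain ⟨⟨p, s⟩, hs⟩ := IsLocalization.surj (denominators K n) f
  have hu := ((IsLocalization.map_units (Ubar K n) s)).map (ofU K n)
  refine hu.mul_right_cancel ?_
  have h1 := hp s
  rw [mul_assoc, ← map_mul, hs, hp, ← hs, map_mul, map_mul, mul_assoc, mul_assoc, h1]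

/-- The letters `x^i` and `∂̄_i`. -/
def letter (i : Fin n) (b : Bool) : Diff K n := if b then x K i else d K i

/-- The sign of the weight of a letter. -/
def sgn (b : Bool) : ℤ := if b then 1 else -1

theorem sgn_not (b : Bool) : sgn (!b) = -sgn b := by cases b <;> simp [sgn]

theorem ht_mul_x (i j : Fin n) :
    ofU K n (ht K i) * x K j = x K j * ofU K n (ht K i + if i = j then 1 else 0) := by
  have h := proj_rel K n (Rel.weight_x i j)
  rwa [map_mul, map_mul] at h

theorem ht_mul_d (i j : Fin n) :
    ofU K n (ht K i) * d K j = d K j * ofU K n (ht K i - if i = j then 1 else 0) := by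
  have h := proj_rel K n (Rel.weight_d i j)
  rwa [map_mul, map_mul] at h

theorem letter_mul_ofU (i : Fin n) (b : Bool) (f : Ubar K n) :
    letter K i b * ofU K n f = ofU K n (shift K (wt i (sgn b)) f) * letter K i b := by
  refine mul_ofU_of_mul_ht K (fun j => ?_) f
  rw [shift_ht, wt, Pi.single_apply]
  cases b
  · have h := ht_mul_d K j i
    by_cases hij : j = i
    · simp only [hij, if_true] at h
      simp only [letter, sgn, hij, if_true, Bool.false_eq_true, if_false, map_sub,
        Int.cast_neg, Int.cast_one, sub_neg_eq_add, map_add, add_mul, h, mul_sub, map_one, mul_one,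
        one_mul, sub_add_cancel]
    · simpa [letter, sgn, hij] using h.symm
  · have h := ht_mul_x K j i
    by_cases hij : j = i
    · simp only [hij, if_true] at h
      simp only [letter, sgn, hij, if_true, map_sub, sub_mul, Int.cast_one, map_add, h, mul_add,
        map_one, mul_one, one_mul, add_sub_cancel_right]
    · simpa [letter, sgn, hij] using h.symm

theorem x_mul_x_of_lt {i j : Fin n} (hij : i < j) : x K i * x K j =
    ofU K n ((hd K i j + 1) * Ring.inverse (hd K i j)) * (x K j * x K i) := by
  have h := proj_rel K n (Rel.x_x i j hij)
  rwa [map_mul, map_mul, map_mul] at h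

theorem d_mul_d_of_lt {i j : Fin n} (hij : i < j) : d K i * d K j =
    ofU K n ((hd K i j - 1) * Ring.inverse (hd K i j)) * (d K j * d K i) := by
  have h := proj_rel K n (Rel.d_d i j hij)
  rwa [map_mul, map_mul, map_mul] at h

theorem x_mul_d_of_lt {i j : Fin n} (hij : i < j) : x K i * d K j = d K j * x K i := by
  have h := proj_rel K n (Rel.x_d_lt i j hij)
  rwa [map_mul, map_mul] at h

theorem x_mul_d_of_gt {i j : Fin n} (hij : j < i) : x K i * d K j =
    ofU K n (hd K i j * (hd K i j - 2) * Ring.inverse ((hd K i j - 1) ^ 2)) *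
      (d K j * x K i) := by
  have h := proj_rel K n (Rel.x_d_gt i j hij)
  rwa [map_mul, map_mul, map_mul] at h

theorem x_mul_d_self (i : Fin n) : x K i * d K i =
    ∑ j, ofU K n (Ring.inverse (1 - hd K i j)) * Gam K j - 1 := by
  have h := proj_rel K n (Rel.x_d_self i)
  rw [map_mul, map_sub, map_sum, map_one] at h
  simp only [map_mul] at h
  exact h

theorem exists_unit_swap {a b : Diff K n}
    (h : ∃ u : Ubar K n, IsUnit u ∧ a * b = ofU K n u * (b * a)) :
    ∃ u : Ubar K n, IsUnit u ∧ b * a = ofU K n u * (a * b) := by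
  obtain ⟨u, hu, e⟩ := h
  refine ⟨Ring.inverse u, hu.ringInverse, ?_⟩
  rw [e, ← mul_assoc, ← map_mul, Ring.inverse_mul_cancel _ hu, map_one, one_mul]

theorem letter_mul_letter_of_lt {i j : Fin n} (hij : i < j) (b b' : Bool) :
    ∃ u : Ubar K n, IsUnit u ∧
      letter K i b * letter K j b' = ofU K n u * (letter K j b' * letter K i b) := by
  cases b <;> cases b'
  · exact ⟨_, (isUnit_hd_sub_one K hij.ne).mul (isUnit_hd K hij.ne).ringInverse,
      d_mul_d_of_lt K hij⟩
  · refine exists_unit_swap K ⟨_, ?_, x_mul_d_of_gt K hij⟩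
    refine ((isUnit_hd K hij.ne').mul ?_).mul ((isUnit_hd_sub_one K hij.ne').pow 2).ringInverse
    simpa [sub_eq_add_neg] using isUnit_hd_add_int K hij.ne' (-2)
  · exact ⟨1, isUnit_one, by rw [map_one, one_mul]; exact x_mul_d_of_lt K hij⟩
  · exact ⟨_, (by simpa using isUnit_hd_add_int K hij.ne 1 :
      IsUnit (hd K i j + 1)).mul (isUnit_hd K hij.ne).ringInverse, x_mul_x_of_lt K hij⟩

theorem letter_mul_letter {i j : Fin n} (hij : i ≠ j) (b b' : Bool) :
    ∃ u : Ubar K n, letter K i b * letter K j b' =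
      ofU K n u * (letter K j b' * letter K i b) := by
  rcases lt_or_gt_of_ne hij with h | h
  · obtain ⟨u, -, hu⟩ := letter_mul_letter_of_lt K h b b'
    exact ⟨u, hu⟩
  · obtain ⟨u, -, hu⟩ := exists_unit_swap K (letter_mul_letter_of_lt K h b' b)
    exact ⟨u, hu⟩

theorem letter_mul_Gam {i j : Fin n} (hij : i ≠ j) (b : Bool) :
    ∃ u : Ubar K n, letter K i b * Gam K j = ofU K n u * (Gam K j * letter K i b) := by
  obtain ⟨u, hu⟩ := letter_mul_letter K hij b false
  obtain ⟨w, hw⟩ := letter_mul_letter K hij b true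
  refine ⟨u * shift K (wt j (sgn false)) w, ?_⟩
  have hG : Gam K j = letter K j false * letter K j true := rfl
  rw [hG, ← mul_assoc, hu, mul_assoc, mul_assoc, hw, ← mul_assoc (letter K j false),
    letter_mul_ofU, map_mul]
  simp only [mul_assoc]

theorem Gam_mul_ofU (j : Fin n) (f : Ubar K n) : Gam K j * ofU K n f = ofU K n f * Gam K j := by
  have hG : Gam K j = letter K j false * letter K j true := rfl
  rw [hG, mul_assoc, letter_mul_ofU, ← mul_assoc, letter_mul_ofU, shift_shift, mul_assoc]
  have : wt j (sgn false) + wt j (sgn true) = 0 := by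
    rw [add_comm]
    exact wt_add_wt_neg j
  rw [this, shift_zero]
  rfl

/-- The factor is left uncomputed; `Gam_mul_Gam` later reads off from the representation that it is
`1`. -/
theorem Gam_mul_Gam_unit {i j : Fin n} (hij : i ≠ j) :
    ∃ u : Ubar K n, Gam K i * Gam K j = ofU K n u * (Gam K j * Gam K i) := by
  obtain ⟨u, hu⟩ := letter_mul_Gam K hij false
  obtain ⟨w, hw⟩ := letter_mul_Gam K hij true
  refine ⟨shift K (wt i (sgn false)) w * u, ?_⟩
  have hG : Gam K i = letter K i false * letter K i true := rfl
  rw [hG, mul_assoc, hw, ← mul_assoc, letter_mul_ofU, mul_assoc, ← mul_assoc (letter K i false),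
    hu, map_mul]
  simp only [mul_assoc]

variable (n) in
/-- The subring generated by `Ū(n)` and the elements `Γ_j`. -/
def gamSubring : Subring (Diff K n) :=
  Subring.closure (Set.range (ofU K n) ∪ Set.range (Gam K))

theorem ofU_mem (f : Ubar K n) : ofU K n f ∈ gamSubring K n :=
  Subring.subset_closure (Or.inl ⟨f, rfl⟩)

theorem Gam_mem (j : Fin n) : Gam K j ∈ gamSubring K n :=
  Subring.subset_closure (Or.inr ⟨j, rfl⟩)

theorem x_mul_d_mem (i : Fin n) : x K i * d K i ∈ gamSubring K n := by
  rw [x_mul_d_self]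
  exact sub_mem (sum_mem fun j _ => mul_mem (ofU_mem K _) (Gam_mem K j)) (one_mem _)

theorem letter_mul_letter_not_mem (i : Fin n) (b : Bool) :
    letter K i b * letter K i (!b) ∈ gamSubring K n := by
  cases b
  · exact Gam_mem K i
  · exact x_mul_d_mem K i

/-- Expand `Γ_i ∂̄_i = ∂̄_i (x^i ∂̄_i)` by the last relation. The term `j = i` has coefficient `1`
and is the wanted product; in the others `∂̄_i` moves to the right past `Γ_j`. -/
theorem d_mul_Gam_self (i : Fin n) : ∃ s ∈ gamSubring K n, d K i * Gam K i = s * d K i := by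
  have h1 : Gam K i * d K i = ∑ j, d K i * (ofU K n (Ring.inverse (1 - hd K i j)) * Gam K j) -
      d K i := by
    rw [Gam, mul_assoc, x_mul_d_self, mul_sub, Finset.mul_sum, mul_one]
  rw [← Finset.add_sum_erase _ _ (Finset.mem_univ i)] at h1
  have h2 : ∀ j ∈ Finset.univ.erase i, ∃ s ∈ gamSubring K n,
      d K i * (ofU K n (Ring.inverse (1 - hd K i j)) * Gam K j) = s * d K i := fun j hj => by
    obtain ⟨u, hu⟩ := letter_mul_Gam K (Finset.ne_of_mem_erase hj).symm false
    have hl : letter K i false = d K i := rfl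
    refine ⟨_, mul_mem (mul_mem (ofU_mem K (shift K (wt i (sgn false))
      (Ring.inverse (1 - hd K i j)))) (ofU_mem K u)) (Gam_mem K j), ?_⟩
    rw [← hl, ← mul_assoc, letter_mul_ofU, mul_assoc, hu]
    simp only [mul_assoc]
  choose! s hs hs' using h2
  rw [Finset.sum_congr rfl hs', ← Finset.sum_mul] at h1
  refine ⟨Gam K i + 1 - ∑ j ∈ Finset.univ.erase i, s j,
    sub_mem (add_mem (Gam_mem K i) (one_mem _)) (sum_mem hs), ?_⟩
  rw [sub_mul, add_mul, h1]
  simp [hd]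

theorem letter_mul_mem (i : Fin n) (b : Bool) {a : Diff K n} (ha : a ∈ gamSubring K n) :
    ∃ s ∈ gamSubring K n, letter K i b * a = s * letter K i b := by
  induction ha using Subring.closure_induction with
  | mem a ha =>
    rcases ha with ⟨f, rfl⟩ | ⟨j, rfl⟩
    · exact ⟨_, ofU_mem K _, letter_mul_ofU K i b f⟩
    · by_cases hij : i = j
      · subst hij
        cases b
        · exact d_mul_Gam_self K i
        · exact ⟨_, x_mul_d_mem K i, (mul_assoc _ _ _).symm⟩
      · obtain ⟨u, hu⟩ := letter_mul_Gam K hij b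
        exact ⟨_, mul_mem (ofU_mem K u) (Gam_mem K j), by rw [hu, mul_assoc]⟩
  | zero => exact ⟨0, zero_mem _, by simp⟩
  | one => exact ⟨1, one_mem _, by simp⟩
  | add a b _ _ iha ihb =>
    obtain ⟨s, hs, es⟩ := iha
    obtain ⟨r, hr, er⟩ := ihb
    exact ⟨s + r, add_mem hs hr, by rw [mul_add, es, er, add_mul]⟩
  | neg a _ iha =>
    obtain ⟨s, hs, es⟩ := iha
    exact ⟨-s, neg_mem hs, by rw [mul_neg, es, neg_mul]⟩
  | mul a b _ _ iha ihb =>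
    obtain ⟨s, hs, es⟩ := iha
    obtain ⟨r, hr, er⟩ := ihb
    exact ⟨s * r, mul_mem hs hr, by rw [← mul_assoc, es, mul_assoc, er, mul_assoc]⟩

/-- The product of a list of letters. -/
def word (l : List (Fin n × Bool)) : Diff K n := (l.map fun p => letter K p.1 p.2).prod

/-- The weight of a list of letters. -/
def wordWt (l : List (Fin n × Bool)) : Fin n → ℤ := (l.map fun p => wt p.1 (sgn p.2)).sum

theorem word_cons (i : Fin n) (b : Bool) (l : List (Fin n × Bool)) :
    word K ((i, b) :: l) = letter K i b * word K l := by simp [word]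

theorem wordWt_cons (i : Fin n) (b : Bool) (l : List (Fin n × Bool)) :
    wordWt ((i, b) :: l) = wt i (sgn b) + wordWt l := by simp [wordWt]

theorem word_mul_ofU (l : List (Fin n × Bool)) (f : Ubar K n) :
    word K l * ofU K n f = ofU K n (shift K (wordWt l) f) * word K l := by
  induction l with
  | nil => simp [word, wordWt, shift_zero]
  | cons p l ih =>
    obtain ⟨i, b⟩ := p
    rw [word_cons, wordWt_cons, mul_assoc, ih, ← mul_assoc, letter_mul_ofU, shift_shift, mul_assoc]

/-- A letter with the sign of the weight of a word can be moved to its left end. -/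
theorem exists_word_eq (N : ℕ) (l : List (Fin n × Bool)) (hl : l.length ≤ N) (i : Fin n) (b : Bool)
    (hw : 0 < sgn b * wordWt l i) :
    ∃ s ∈ gamSubring K n, ∃ l' : List (Fin n × Bool),
      word K l = s * (letter K i b * word K l') ∧ wordWt l = wt i (sgn b) + wordWt l' ∧
        l'.length < l.length := by
  induction N generalizing l with
  | zero =>
    rw [List.length_eq_zero_iff.1 (Nat.le_zero.1 hl)] at hw
    simp [wordWt] at hw
  | succ N ih =>
    rcases l with _ | ⟨⟨j, b'⟩, l⟩
    · simp [wordWt] at hw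
    have hlN : l.length ≤ N := by simpa using hl
    rw [wordWt_cons, Pi.add_apply] at hw
    by_cases hij : j = i
    · subst hij
      by_cases hb : b' = b
      · subst hb
        exact ⟨1, one_mem _, l, by rw [one_mul, word_cons], wordWt_cons _ _ _, by simp⟩
      · have hb : b' = !b := by cases b <;> cases b' <;> simp_all
        subst hb
        have hlast : wt j (sgn !b) + wt j (sgn b) = 0 := by
          rw [sgn_not, wt, wt, ← Pi.single_add, neg_add_cancel, Pi.single_zero]
        have hs : sgn b * sgn (!b) = -1 := by cases b <;> simp [sgn]
        -- The opposite leading letter contributes `-1`, so the tail has signed weight at least `2`.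
        -- One matching letter can cancel the leading one, and the remaining word still has positive
        -- signed weight.
        have hwl : 0 < sgn b * wordWt l j := by
          simp only [wt, Pi.single_eq_same, mul_add, hs] at hw
          omega
        obtain ⟨s, hs, l', e1, e2, e3⟩ := ih l hlN hwl
        have hwt : wordWt ((j, !b) :: l) = wordWt l' := by
          rw [wordWt_cons, e2, ← add_assoc, hlast, zero_add]
        obtain ⟨s', hs', e⟩ := letter_mul_mem K j (!b) hs
        have hm := letter_mul_letter_not_mem K j (!b)
        rw [Bool.not_not] at hm
        obtain ⟨r, hr, l'', f1, f2, f3⟩ := ih l' (by omega) (by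
          rw [← hwt, wordWt_cons, Pi.add_apply]; exact hw)
        refine ⟨s' * (letter K j (!b) * letter K j b) * r, mul_mem (mul_mem hs' hm) hr, l'', ?_,
          hwt.trans f2, by simp; omega⟩
        have h4 : s' * letter K j (!b) * (letter K j b * word K l') =
            s' * (letter K j (!b) * letter K j b) * word K l' := by simp only [mul_assoc]
        rw [word_cons, e1, ← mul_assoc, e, h4, f1]
        simp only [mul_assoc]
    · have hwl : 0 < sgn b * wordWt l i := by
        simpa [wt, Ne.symm hij] using hw
      obtain ⟨s, hs, l', e1, e2, e3⟩ := ih l hlN hwl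
      obtain ⟨s', hs', e⟩ := letter_mul_mem K j b' hs
      obtain ⟨u, hu⟩ := letter_mul_letter K hij b' b
      refine ⟨s' * ofU K n u, mul_mem hs' (ofU_mem K u), (j, b') :: l', ?_, ?_, by simpa using e3⟩
      · rw [word_cons, word_cons, e1, ← mul_assoc, e, mul_assoc, ← mul_assoc (letter K j b'), hu]
        simp only [mul_assoc]
      · rw [wordWt_cons, wordWt_cons, e2, add_left_comm]

/-- The tail has weight opposite to the first letter, so the opposite letter can be brought next to
it; the pair lies in `gamSubring` and a shorter word of weight zero remains. -/
theorem word_mem (N : ℕ) (l : List (Fin n × Bool)) (hl : l.length ≤ N) (hw : wordWt l = 0) :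
    word K l ∈ gamSubring K n := by
  induction N generalizing l with
  | zero =>
    rw [List.length_eq_zero_iff.1 (Nat.le_zero.1 hl)]
    exact one_mem _
  | succ N ih =>
    rcases l with _ | ⟨⟨i, b⟩, l⟩
    · exact one_mem _
    have hl : l.length ≤ N := by simpa using hl
    rw [wordWt_cons] at hw
    have hwl := eq_neg_of_add_eq_zero_right hw
    obtain ⟨s, hs, l', e1, e2, e3⟩ := exists_word_eq K _ l le_rfl i (!b) (by
      rw [hwl]
      cases b <;> simp [sgn, wt])
    obtain ⟨s', hs', e⟩ := letter_mul_mem K i b hs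
    have hl' := ih l' (by omega) (by
      have h2 : wt i (sgn b) + wt i (sgn !b) = 0 := by
        rw [sgn_not, wt, wt, ← Pi.single_add, add_neg_cancel, Pi.single_zero]
      rw [e2, ← add_assoc, h2, zero_add] at hw
      exact hw)
    rw [word_cons, e1, ← mul_assoc, e, mul_assoc, ← mul_assoc (letter K i b)]
    exact mul_mem hs' (mul_mem (letter_mul_letter_not_mem K i b) hl')

theorem ofU_mul_of_mem (f : Ubar K n) {a : Diff K n} (ha : a ∈ gamSubring K n) :
    ofU K n f * a = a * ofU K n f := by
  induction ha using Subring.closure_induction with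
  | mem a ha =>
    rcases ha with ⟨g, rfl⟩ | ⟨j, rfl⟩
    · rw [← map_mul, mul_comm, map_mul]
    · exact (Gam_mul_ofU K j f).symm
  | zero => simp
  | one => simp
  | add a b _ _ iha ihb => rw [mul_add, iha, ihb, add_mul]
  | neg a _ iha => rw [mul_neg, iha, neg_mul]
  | mul a b _ _ iha ihb => rw [← mul_assoc, iha, mul_assoc, ihb, mul_assoc]

/-- The span contains `1` and is stable under left multiplication by every generator. -/
theorem mem_span_word (a : Diff K n) : a ∈ AddSubgroup.closure
    {z : Diff K n | ∃ s ∈ gamSubring K n, ∃ l, z = s * word K l} := by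
  set A := AddSubgroup.closure {z : Diff K n | ∃ s ∈ gamSubring K n, ∃ l, z = s * word K l}
  have key : ∀ (p : FreeAlgebra K (Gen K n)) (m : Diff K n), m ∈ A → proj K n p * m ∈ A := by
    have hgen : ∀ (z : Diff K n), (∀ s ∈ gamSubring K n, ∀ l, z * (s * word K l) ∈ A) →
        ∀ m ∈ A, z * m ∈ A := fun z hz m hm => by
      induction hm using AddSubgroup.closure_induction with
      | mem m hm =>
        obtain ⟨s, hs, l, rfl⟩ := hm
        exact hz s hs l
      | zero => simp
      | add a b _ _ iha ihb => rw [mul_add]; exact add_mem iha ihb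
      | neg a _ iha => rw [mul_neg]; exact neg_mem iha
    have hU : ∀ f : Ubar K n, ∀ m ∈ A, ofU K n f * m ∈ A := fun f => hgen _ fun s hs l =>
      AddSubgroup.subset_closure ⟨_, mul_mem (ofU_mem K f) hs, l, (mul_assoc _ _ _).symm⟩
    have hL : ∀ i b, ∀ m ∈ A, letter K i b * m ∈ A := fun i b => hgen _ fun s hs l => by
      obtain ⟨s', hs', e⟩ := letter_mul_mem K i b hs
      exact AddSubgroup.subset_closure ⟨s', hs', (i, b) :: l, by
        rw [word_cons, ← mul_assoc, e, mul_assoc]⟩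
    intro p
    induction p using FreeAlgebra.induction with
    | grade0 r =>
      intro m hm
      rw [AlgHom.commutes, ← (ofU K n).commutes]
      exact hU _ m hm
    | grade1 g =>
      cases g with
      | coeff f => exact hU f
      | x i => exact hL i true
      | d i => exact hL i false
    | mul p q hp hq =>
      intro m hm
      rw [map_mul, mul_assoc]
      exact hp _ (hq m hm)
    | add p q hp hq =>
      intro m hm
      rw [map_add, add_mul]
      exact add_mem (hp m hm) (hq m hm)
  obtain ⟨p, rfl⟩ := RingQuot.mkAlgHom_surjective K (Rel K n) a
  have h := key p 1 (AddSubgroup.subset_closure ⟨1, one_mem _, [], by simp [word]⟩)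
  rwa [mul_one] at h

/-- The operator `f ↦ h̃_i f - f h̃_i`. -/
def adH (i : Fin n) : Module.End K (Diff K n) :=
  LinearMap.mulLeft K (ofU K n (ht K i)) - LinearMap.mulRight K (ofU K n (ht K i))

theorem adH_apply (i : Fin n) (f : Diff K n) :
    adH K i f = ofU K n (ht K i) * f - f * ofU K n (ht K i) := rfl

theorem adH_commute (i j : Fin n) : Commute (adH K i) (adH K j) := by
  ext f
  have h : ofU K n (ht K i) * ofU K n (ht K j) = ofU K n (ht K j) * ofU K n (ht K i) := by
    rw [← map_mul, mul_comm, map_mul]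
  have h' : ofU K n (ht K i) * (ofU K n (ht K j) * f) =
      ofU K n (ht K j) * (ofU K n (ht K i) * f) := by rw [← mul_assoc, h, mul_assoc]
  simp only [Module.End.mul_apply, adH_apply, mul_sub, sub_mul, mul_assoc]
  rw [h', h]
  abel

theorem adH_mul_word (i : Fin n) {s : Diff K n} (hs : s ∈ gamSubring K n)
    (l : List (Fin n × Bool)) :
    adH K i (s * word K l) = ((wordWt l i : ℤ) : K) • (s * word K l) := by
  rw [adH_apply, mul_assoc s, word_mul_ofU, shift_ht, map_sub, sub_mul, mul_sub, ← mul_assoc,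
    ofU_mul_of_mem K _ hs, mul_assoc, sub_sub_cancel, map_intCast, Algebra.smul_def, map_intCast,
    ← mul_assoc, ← mul_assoc, (Int.cast_commute _ s).eq]

/-- Each `s * word l` is a joint eigenvector of the commuting operators `adH i`. Independence of the
joint generalized eigenspaces kills the part of `a` coming from words of nonzero weight. -/
theorem weightZero_le [CharZero K] {a : Diff K n} (ha : a ∈ weightZero K n) :
    a ∈ gamSubring K n := by
  let E : (Fin n → K) → Submodule K (Diff K n) :=
    fun χ => ⨅ i, (adH K i).maxGenEigenspace (χ i)
  have hind : iSupIndep E :=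
    Module.End.independent_iInf_maxGenEigenspace_of_forall_mapsTo _ fun i j φ =>
      Module.End.mapsTo_maxGenEigenspace_of_comm (adH_commute K j i) φ
  have hmem : ∀ (χ : Fin n → K) (z : Diff K n), (∀ i, adH K i z = χ i • z) → z ∈ E χ :=
    fun χ z hz => (Submodule.mem_iInf _).2 fun i => by
      refine (Module.End.genEigenspace (adH K i) (χ i)).monotone
        (le_top (a := 1)) ?_
      exact Module.End.mem_eigenspace_iff.2 (hz i)
  have hS : ∀ s ∈ gamSubring K n, s ∈ E 0 := fun s hs => hmem 0 s fun i => by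
    rw [adH_apply, ofU_mul_of_mem K _ hs, sub_self, Pi.zero_apply, zero_smul]
  have hdec : ∀ z : Diff K n, ∃ s ∈ gamSubring K n, z - s ∈ ⨆ (χ) (_ : χ ≠ 0), E χ := by
    intro z
    induction mem_span_word K z using AddSubgroup.closure_induction with
    | mem z hz =>
      obtain ⟨s, hs, l, rfl⟩ := hz
      by_cases hl : wordWt l = 0
      · exact ⟨_, mul_mem hs (word_mem K _ l le_rfl hl), by rw [sub_self]; exact zero_mem _⟩
      · refine ⟨0, zero_mem _, ?_⟩
        rw [sub_zero]
        refine Submodule.mem_iSup_of_mem (fun i => ((wordWt l i : ℤ) : K))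
          (Submodule.mem_iSup_of_mem (fun h => hl ?_) (hmem _ _ fun i => adH_mul_word K i hs l))
        -- Characteristic zero enters here: an integer weight that vanishes in `K` is zero.
        ext i
        simpa using congrFun h i
    | zero => exact ⟨0, zero_mem _, by simp⟩
    | add a b _ _ iha ihb =>
      obtain ⟨s, hs, es⟩ := iha
      obtain ⟨r, hr, er⟩ := ihb
      exact ⟨s + r, add_mem hs hr, by rw [add_sub_add_comm]; exact add_mem es er⟩
    | neg a _ iha =>
      obtain ⟨s, hs, es⟩ := iha
      exact ⟨-s, neg_mem hs, by rw [← neg_sub']; exact neg_mem es⟩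
  obtain ⟨s, hs, hsub⟩ := hdec a
  have ha0 : a ∈ E 0 := hmem 0 a fun i => by
    have h := ha i
    rw [Pi.zero_apply, map_zero, add_zero] at h
    rw [adH_apply, h, sub_self, Pi.zero_apply, zero_smul]
  have h0 := (Submodule.disjoint_def.1 (hind 0)) _ (sub_mem ha0 (hS s hs)) hsub
  rw [sub_eq_zero.1 h0]
  exact hs

theorem mem_weightZero_iff [CharZero K] {a : Diff K n} :
    a ∈ weightZero K n ↔ a ∈ gamSubring K n := by
  refine ⟨weightZero_le K, fun ha i => ?_⟩
  rw [Pi.zero_apply, map_zero, add_zero, ofU_mul_of_mem K _ ha]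

end WeightZero

/-! ### The isomorphism with `Ū(n)[t_1, …, t_n]`, and the center. -/

section Center

variable (K : Type u) [Field K] {n : ℕ}

theorem ht_ne_zero (i : Fin n) : ht K i ≠ 0 := fun h =>
  X_ne_zero (R := K) i (Ubar_algebraMap_injective K n (by rw [map_zero]; exact h))

theorem gam_ne_zero (i : Fin n) : gam K i ≠ 0 := fun h => by
  have h1 := prod_mul_gam K i
  rw [h, mul_zero] at h1
  have h2 : toFld K n (∑ k : Fin n, X k * C (-ht K i) ^ (n - ((k : ℕ) + 1)) -
      C (-ht K i) ^ n) = toFld K n 0 := by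
    rw [map_zero, h1]
    simp [t, H]
  -- Setting all `t_k = 0` leaves only `-(-h̃_i)^n`, which is nonzero.
  have h3 := congrArg (eval 0) (toFld_injective K n h2)
  simp only [map_sub, map_sum, map_mul, eval_X, Pi.zero_apply, zero_mul, Finset.sum_const_zero,
    map_pow, eval_C, map_zero, zero_sub, neg_eq_zero] at h3
  exact ht_ne_zero K i (neg_eq_zero.1 (eq_zero_of_pow_eq_zero h3))

theorem opHom_injective : Function.Injective (opHom K (n := n)) := fun f g h => by
  have h1 := congrArg (fun a : Module.End K (Fld K n) => a 1) h
  change f * fldShift K 0 1 = g * fldShift K 0 1 at h1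
  simpa using h1

theorem op_left_injective (v : Fin n → ℤ) : Function.Injective fun f => op K (n := n) f v :=
  fun f g h => by
    have h1 := congrArg (fun a : Module.End K (Fld K n) => a 1) h
    change f * fldShift K v 1 = g * fldShift K v 1 at h1
    simpa using h1

/-- The nonvanishing of the coefficient is what permits cancelling a letter after applying `rep`. -/
theorem rep_letter [Infinite K] (i : Fin n) (b : Bool) :
    ∃ f, f ≠ 0 ∧ rep K (letter K i b) = op K f (wt i (sgn b)) := by
  cases b
  · exact ⟨_, mul_ne_zero (gam_ne_zero K i)
      (left_ne_zero_of_mul_eq_one (dCoeff_mul_fldShift_xCoeff K i)), rep_d K i⟩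
  · exact ⟨_, left_ne_zero_of_mul_eq_one (xCoeff_mul_fldShift_dCoeff K i), rep_x K i⟩

variable [CharZero K]

theorem Gam_mul_Gam (i j : Fin n) : Gam K i * Gam K j = Gam K j * Gam K i := by
  by_cases hij : i = j
  · rw [hij]
  obtain ⟨u, hu⟩ := Gam_mul_Gam_unit K hij
  have h := congrArg (rep K) hu
  simp only [map_mul, rep_Gam, rep_ofU] at h
  rw [← map_mul, ← map_mul, ← map_mul, mul_comm (gam K i)] at h
  have h1 := mul_right_cancel₀ (mul_ne_zero (gam_ne_zero K j) (gam_ne_zero K i))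
    ((one_mul _).trans (opHom_injective K h))
  have h2 : u = 1 := by
    have h3 : toFld K n (C u) = toFld K n (C 1) := by rw [← h1, map_one, map_one]
    exact C_injective _ _ (toFld_injective K n h3)
  rw [hu, h2, map_one, one_mul]

theorem gamSubring_mul_comm {a b : Diff K n} (ha : a ∈ gamSubring K n) (hb : b ∈ gamSubring K n) :
    a * b = b * a := by
  have := Subring.isMulCommutative_closure (s := Set.range (ofU K n) ∪ Set.range (Gam K)) (by
    rintro x (⟨f, rfl⟩ | ⟨i, rfl⟩) y (⟨g, rfl⟩ | ⟨j, rfl⟩)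
    · rw [← map_mul, mul_comm, map_mul]
    · exact (Gam_mul_ofU K j f).symm
    · exact Gam_mul_ofU K i g
    · exact Gam_mul_Gam K i j)
  exact congrArg Subtype.val (this.is_comm.comm ⟨a, ha⟩ ⟨b, hb⟩)

/-- The subring of weight zero elements is commutative. -/
abbrev weightZeroCommRing : CommRing (weightZero K n) :=
  { (inferInstance : Ring (weightZero K n)) with
    mul_comm := fun a b => Subtype.ext
      (gamSubring_mul_comm K (weightZero_le K a.2) (weightZero_le K b.2)) }

attribute [local instance] weightZeroCommRing

variable (n) in
/-- The structure homomorphism from `Ū(n)` to the subring of weight zero elements. -/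
def ofUZero : Ubar K n →+* weightZero K n :=
  (ofU K n).toRingHom.codRestrict _ fun f => (mem_weightZero_iff K).2 (ofU_mem K f)

/-- The subring of weight zero elements is an algebra over `K`. -/
abbrev weightZeroAlgebra : Algebra K (weightZero K n) :=
  ((ofUZero K n).comp (algebraMap K (Ubar K n))).toAlgebra

attribute [local instance] weightZeroAlgebra

theorem coe_ofUZero (f : Ubar K n) : (ofUZero K n f : Diff K n) = ofU K n f := rfl

/-- The element `Γ_j` of the subring of weight zero elements. -/
def GamZero (j : Fin n) : weightZero K n := ⟨Gam K j, (mem_weightZero_iff K).2 (Gam_mem K j)⟩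

theorem aeval_ofUZero (p : MvPolynomial (Fin n) K) :
    aeval (fun i => ofUZero K n (ht K i)) p = ofUZero K n (algebraMap _ (Ubar K n) p) := by
  have : (aeval (fun i => ofUZero K n (ht K i)) : _ →ₐ[K] weightZero K n).toRingHom =
      (ofUZero K n).comp (algebraMap (MvPolynomial (Fin n) K) (Ubar K n)) := by
    refine MvPolynomial.ringHom_ext (fun a => ?_) fun i => ?_
    · simp
      rfl
    · simp [ht]
  exact RingHom.congr_fun this p

/-- The element `c_k` of the subring of weight zero elements. -/
def cZero (k : ℕ) : weightZero K n :=
  cpoly K n (fun i => ofUZero K n (ht K i)) (GamZero K) k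

theorem coe_cZero (k : ℕ) : ((cZero K k : weightZero K n) : Diff K n) = c K n k := by
  simp only [cZero, cpoly, aeval_ofUZero]
  exact (map_sub (weightZero K n).subtype _ _).trans
    (congrArg (· - _) (map_sum (weightZero K n).subtype _ _))

variable (n) in
/-- The evaluation `t_j ↦ c_j` from `Ū(n)[t_1, …, t_n]` to the subring of weight zero elements. -/
def evalC : MvPolynomial (Fin n) (Ubar K n) →+* weightZero K n :=
  eval₂Hom (ofUZero K n) fun j => cZero K (j + 1)

theorem evalC_C (f : Ubar K n) : evalC K n (C f) = ofUZero K n f := eval₂Hom_C _ _ _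

theorem evalC_X (j : Fin n) : evalC K n (X j) = cZero K (j + 1) := eval₂Hom_X' _ _ _

theorem rep_evalC (p : MvPolynomial (Fin n) (Ubar K n)) :
    rep K (evalC K n p : Diff K n) = opHom K (toFld K n p) := by
  have : ((rep K).toRingHom.comp (weightZero K n).subtype).comp (evalC K n) =
      (opHom K).comp (toFld K n) := by
    refine MvPolynomial.ringHom_ext (fun f => ?_) fun j => ?_
    · change rep K (evalC K n (C f) : Diff K n) = opHom K (toFld K n (C f))
      rw [evalC_C, coe_ofUZero, rep_ofU]
    · change rep K (evalC K n (X j) : Diff K n) = opHom K (t K j)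
      rw [evalC_X, coe_cZero, rep_c]
  exact RingHom.congr_fun this p

theorem evalC_injective : Function.Injective (evalC K n) := fun p q h => by
  have h1 := rep_evalC K p
  rw [h, rep_evalC] at h1
  exact (toFld_injective K n (opHom_injective K h1)).symm

variable (n) in
/-- The range of the evaluation `t_j ↦ c_j`. -/
def evalCRange : Subring (weightZero K n) :=
  RingHom.range (R := MvPolynomial (Fin n) (Ubar K n)) (S := weightZero K n) (evalC K n)

theorem GamZero_mem_range (j : Fin n) : GamZero K j ∈ evalCRange K n := by
  have hU : ∀ f, ofUZero K n f ∈ evalCRange K n := fun f => ⟨C f, evalC_C K f⟩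
  have h := sum_cpoly_mul_neg_pow K n (fun i => ofUZero K n (ht K i)) (GamZero K) j
  simp only [← map_sub, ← map_prod] at h
  have hu : IsUnit (∏ l ∈ Finset.univ.erase j, (ht K l - ht K j)) :=
    IsUnit.prod_iff.2 fun l hl => isUnit_hd K (Finset.ne_of_mem_erase hl)
  have h1 : GamZero K j = ofUZero K n (Ring.inverse (∏ l ∈ Finset.univ.erase j,
      (ht K l - ht K j))) * (∑ k : Fin n, cZero K (k + 1) * (-ofUZero K n (ht K j)) ^
        (n - ((k : ℕ) + 1)) - (-ofUZero K n (ht K j)) ^ n) := by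
    simp only [cZero]
    rw [h, add_sub_cancel_right, ← mul_assoc, ← map_mul, Ring.inverse_mul_cancel _ hu, map_one,
      one_mul]
  rw [h1]
  exact mul_mem (hU _) (sub_mem (sum_mem fun k _ => mul_mem ⟨X k, evalC_X K k⟩
    (pow_mem (neg_mem (hU _)) _)) (pow_mem (neg_mem (hU _)) _))

theorem evalC_surjective : Function.Surjective (evalC K n) := by
  have h : gamSubring K n ≤ (evalCRange K n).map (weightZero K n).subtype := by
    refine Subring.closure_le.2 ?_
    rintro _ (⟨f, rfl⟩ | ⟨j, rfl⟩)
    · exact ⟨ofUZero K n f, ⟨C f, evalC_C K f⟩, rfl⟩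
    · exact ⟨GamZero K j, GamZero_mem_range K j, rfl⟩
  intro a
  obtain ⟨b, ⟨p, hp⟩, hb⟩ := h (weightZero_le K a.2)
  exact ⟨p, hp.trans (Subtype.ext hb)⟩

theorem exists_evalC_eq {a : Diff K n} (ha : a ∈ weightZero K n) :
    ∃ p, (evalC K n p : Diff K n) = a := by
  obtain ⟨p, hp⟩ := evalC_surjective K ⟨a, ha⟩
  exact ⟨p, congrArg Subtype.val hp⟩

theorem evalC_mul_letter_injective (i : Fin n) (b : Bool) {p q : MvPolynomial (Fin n) (Ubar K n)}
    (h : (evalC K n p : Diff K n) * letter K i b = evalC K n q * letter K i b) : p = q := by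
  obtain ⟨f, hf, e⟩ := rep_letter K i b
  have h1 := congrArg (rep K) h
  rw [map_mul, map_mul, rep_evalC, rep_evalC, e, opHom_mul_op, opHom_mul_op] at h1
  exact toFld_injective K n (mul_right_cancel₀ hf (op_left_injective K _ h1))

/-- By `letter_mul_mem` some polynomial `q` works on the right; comparing operators shows that `q`
is the shift of `p`. As shifts fix the variables, this gives the centrality of the `c_k`. -/
theorem letter_mul_evalC (i : Fin n) (b : Bool) (p : MvPolynomial (Fin n) (Ubar K n)) :
    letter K i b * (evalC K n p : Diff K n) =
      evalC K n (map (shift K (wt i (sgn b))) p) * letter K i b := by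
  obtain ⟨s, hs, h⟩ := letter_mul_mem K i b (weightZero_le K (evalC K n p).2)
  obtain ⟨q, rfl⟩ := exists_evalC_eq K ((mem_weightZero_iff K).2 hs)
  obtain ⟨f, hf, e⟩ := rep_letter K i b
  have h1 := congrArg (rep K) h
  rw [map_mul, map_mul, rep_evalC, rep_evalC, e, opHom_mul_op, op_mul_opHom, fldShift_toFld,
    mul_comm f] at h1
  rw [toFld_injective K n (mul_right_cancel₀ hf (op_left_injective K _ h1)), h]

omit [CharZero K] in
theorem mem_center_of_commute {z : Diff K n} (hU : ∀ f, ofU K n f * z = z * ofU K n f)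
    (hL : ∀ i b, letter K i b * z = z * letter K i b) : z ∈ Subalgebra.center K (Diff K n) := by
  refine Subalgebra.mem_center_iff.2 fun a => ?_
  obtain ⟨p, rfl⟩ := RingQuot.mkAlgHom_surjective K (Rel K n) a
  change proj K n p * z = z * proj K n p
  induction p using FreeAlgebra.induction with
  | grade0 r => rw [AlgHom.commutes, Algebra.commutes]
  | grade1 g =>
    cases g with
    | coeff f => exact hU f
    | x i => exact hL i true
    | d i => exact hL i false
  | mul p q hp hq => rw [map_mul, mul_assoc, hq, ← mul_assoc, hp, mul_assoc]
  | add p q hp hq => rw [map_add, add_mul, mul_add, hp, hq]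

theorem c_mem_center (j : Fin n) : c K n (j + 1) ∈ Subalgebra.center K (Diff K n) := by
  rw [← coe_cZero, ← evalC_X]
  refine mem_center_of_commute K (fun f => ofU_mul_of_mem K f (weightZero_le K (evalC K n _).2))
    fun i b => ?_
  rw [letter_mul_evalC, map_X]

/-- Write `f = p / s` and choose `h0` with `s(h0) ≠ 0`. Invariance makes `f` take one value on the
points of `h0 + ℤ^n`, in cross-multiplied form; this lattice is Zariski dense in characteristic
zero. -/
theorem eq_algebraMap_of_shift {f : Ubar K n} (hf : ∀ i, shift K (wt i 1) f = f) :
    ∃ a : K, algebraMap K (Ubar K n) a = f := by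
  have hv : ∀ v, shift K v f = f := by
    let A : AddSubgroup (Fin n → ℤ) :=
      { carrier := {v | shift K v f = f}
        zero_mem' := by simp [shift_zero]
        add_mem' := fun {v w} hv hw => by
          change shift K (v + w) f = f
          rw [← shift_shift, hw, hv]
        neg_mem' := fun {v} hv => by
          change shift K (-v) f = f
          conv_lhs => rw [← (hv : shift K v f = f), shift_neg_shift] }
    intro v
    have : v ∈ A := by
      rw [← Finset.univ_sum_single v]
      refine sum_mem fun i _ => ?_
      have h1 : (Pi.single i (v i) : Fin n → ℤ) = v i • wt i 1 := by
        rw [wt, ← Pi.single_smul, smul_eq_mul, mul_one]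
      rw [h1]
      exact zsmul_mem (hf i : wt i 1 ∈ A) _
    exact this
  obtain ⟨⟨p, s, hs⟩, hps⟩ := IsLocalization.surj (denominators K n) f
  have hs0 : s ≠ 0 := nonZeroDivisors.ne_zero (denominators_le_nonZeroDivisors K n hs)
  change f * algebraMap _ _ s = algebraMap _ _ p at hps
  have hpoly : ∀ v, p * polyShift K v s = polyShift K v p * s := fun v => by
    apply Ubar_algebraMap_injective K n
    rw [map_mul, map_mul, ← hps, ← shift_algebraMap, ← shift_algebraMap, ← hps, map_mul, hv v]
    ring
  obtain ⟨h0, hh0⟩ : ∃ h0, eval h0 s ≠ 0 := by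
    by_contra! h
    exact hs0 (MvPolynomial.funext fun x => by rw [h x, map_zero])
  have heval : ∀ v : Fin n → ℤ, ∀ q : MvPolynomial (Fin n) K,
      eval h0 (polyShift K v q) = eval (fun i => h0 i - ((v i : ℤ) : K)) q := fun v q => by
    rw [polyShift, ← coe_aeval_eq_eval, ← coe_aeval_eq_eval]
    change ((aeval h0).comp (aeval _)) q = aeval _ q
    rw [comp_aeval]
    simp
  have hq : C (eval h0 p) * s = C (eval h0 s) * p := by
    refine MvPolynomial.funext_set (fun i => Set.range fun m : ℤ => h0 i - (m : K)) (fun i =>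
      Set.infinite_range_of_injective fun a b hab => ?_) fun y hy => ?_
    · simpa using hab
    · choose v hv using fun i => hy i (Set.mem_univ i)
      have h1 := congrArg (eval h0) (hpoly v)
      rw [map_mul, map_mul, heval, heval, show (fun i => h0 i - ((v i : ℤ) : K)) = y from
        _root_.funext hv] at h1
      rw [map_mul, map_mul, eval_C, eval_C, h1, mul_comm]
  refine ⟨eval h0 p / eval h0 s, ?_⟩
  have hu := IsLocalization.map_units (Ubar K n) (⟨s, hs⟩ : denominators K n)
  refine hu.mul_right_cancel ?_
  change _ * algebraMap _ _ s = f * algebraMap _ _ s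
  rw [hps, IsScalarTower.algebraMap_apply K (MvPolynomial (Fin n) K) (Ubar K n), ← map_mul]
  congr 1
  refine mul_left_cancel₀ ((map_ne_zero_iff _ (C_injective (Fin n) K)).2 hh0) ?_
  rw [← hq, MvPolynomial.algebraMap_eq, ← mul_assoc, ← map_mul, mul_div_cancel₀ _ hh0]

variable (n) in
/-- The homomorphism `t_j ↦ c_j` to the center. -/
def centerHom : MvPolynomial (Fin n) K →ₐ[K] Subalgebra.center K (Diff K n) :=
  aeval fun j => ⟨c K n (j + 1), c_mem_center K j⟩

theorem coe_centerHom (p : MvPolynomial (Fin n) K) :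
    (centerHom K n p : Diff K n) = evalC K n (map (algebraMap K (Ubar K n)) p) := by
  have : (Subalgebra.center K (Diff K n)).val.toRingHom.comp (centerHom K n).toRingHom =
      ((weightZero K n).subtype.comp (evalC K n)).comp (map (algebraMap K (Ubar K n))) := by
    refine MvPolynomial.ringHom_ext (fun a => ?_) fun j => ?_
    · change ((centerHom K n (C a) : Subalgebra.center K (Diff K n)) : Diff K n) =
        evalC K n (map (algebraMap K (Ubar K n)) (C a))
      rw [map_C, evalC_C, coe_ofUZero, AlgHom.commutes, ← MvPolynomial.algebraMap_eq,
        AlgHom.commutes]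
      rfl
    · change ((centerHom K n (X j) : Subalgebra.center K (Diff K n)) : Diff K n) =
        evalC K n (map (algebraMap K (Ubar K n)) (X j))
      rw [map_X, evalC_X, coe_cZero, centerHom, aeval_X]
  exact RingHom.congr_fun this p

theorem centerHom_injective : Function.Injective (centerHom K n) := fun p q h => by
  have h1 := congrArg Subtype.val h
  rw [coe_centerHom, coe_centerHom] at h1
  exact map_injective _ (algebraMap K (Ubar K n)).injective
    (evalC_injective K (Subtype.ext h1))

/-- Commuting with the `h̃_i` gives `z = evalC p`; commuting with the `x^i` makes every coefficient
of `p` shift invariant, hence constant. -/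
theorem centerHom_surjective : Function.Surjective (centerHom K n) := by
  rintro ⟨z, hz⟩
  have hz' := Subalgebra.mem_center_iff.1 hz
  obtain ⟨p, rfl⟩ := exists_evalC_eq K (a := z) (fun i => by
    rw [Pi.zero_apply, map_zero, add_zero, hz'])
  have hp : ∀ i, map (shift K (wt i 1)) p = p := fun i => by
    refine evalC_mul_letter_injective K i true ?_
    rw [← hz' (letter K i true), letter_mul_evalC]
    rfl
  have hcoef : p ∈ Set.range (map (algebraMap K (Ubar K n)) : MvPolynomial (Fin n) K →+* _) := by
    rw [MvPolynomial.mem_range_map_iff_coeffs_subset]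
    intro f hf
    obtain ⟨m, -, rfl⟩ := MvPolynomial.mem_coeffs_iff.1 hf
    obtain ⟨a, ha⟩ := eq_algebraMap_of_shift K (f := coeff m p) fun i => by
      conv_rhs => rw [← hp i, coeff_map]
    exact ⟨a, ha⟩
  obtain ⟨q, rfl⟩ := hcoef
  exact ⟨q, Subtype.ext (coe_centerHom K q)⟩

end Center

end HDiff

end

theorem mainTheorem4 (K : Type*) [Field K] [CharZero K] (n : ℕ) :
    (∃ φ : MvPolynomial (Fin n) K ≃ₐ[K] Subalgebra.center K (HDiff.Diff K n),
      ∀ j : Fin n, (φ (MvPolynomial.X j) : HDiff.Diff K n) = HDiff.c K n (j + 1)) ∧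
    (∃ ψ : MvPolynomial (Fin n) (HDiff.Ubar K n) ≃+* HDiff.weightZero K n,
      (∀ f : HDiff.Ubar K n,
        (ψ (MvPolynomial.C f) : HDiff.Diff K n) = HDiff.ofU K n f) ∧
      ∀ j : Fin n, (ψ (MvPolynomial.X j) : HDiff.Diff K n) = HDiff.c K n (j + 1)) := by
  refine ⟨⟨AlgEquiv.ofBijective (HDiff.centerHom K n)
    ⟨HDiff.centerHom_injective K, HDiff.centerHom_surjective K⟩, fun j => ?_⟩,
    RingEquiv.ofBijective (HDiff.evalC K n)
      ⟨HDiff.evalC_injective K, HDiff.evalC_surjective K⟩, fun f => ?_, fun j => ?_⟩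
  · exact congrArg Subtype.val (MvPolynomial.aeval_X _ j)
  · exact congrArg Subtype.val (HDiff.evalC_C K f)
  · exact (congrArg Subtype.val (HDiff.evalC_X K j)).trans (HDiff.coe_cZero K _)
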